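/- Let $p \ge q \ge 0$ be integers and $n = p+q$. A real $2m\times 2m$ matrix $S$ is called symplectic, $S\in \mathrm{Sp}(2m,\mathbb{R})$, if $S^T J_m S = J_m$ with $J_m = \begin{bmatrix} 0 & I_m\\ -I_m & 0\end{bmatrix}$. Let $$P = P_{p,q} = \begin{bmatrix} I_p & 0 & 0 & 0\\ 0 & 0 & I_p & 0\\ 0 & I_q & 0 & 0\\ 0 & 0 & 0 & I_q\end{bmatrix}$$ (block rows of sizes $p,p,q,q$, block columns of sizes $p,q,p,q$) and let $f(A) = P^T A P$. For $\theta = (\theta_1,\dots,\theta_q)\in\mathbb{R}^q$ put $Ch = \mathrm{diag}(\cosh\theta_1,\dots,\cosh\theta_q)$, $Sh = \mathrm{diag}(\sinh\theta_1,\dots,\sinh\theta_q)$ and $$H = H(\theta) = \begin{bmatrix} Ch & 0 & Sh\\ 0 & I_{p-q} & 0\\ Sh & 0 & Ch\end{bmatrix}\in\mathbb{R}^{n\times n}.$$ **Theorem.** For every $S\in \mathrm{Sp}(2n,\mathbb{R})$ there exist an orthogonal symplectic $2n\times 2n$ matrix $O$, real symplectic matrices $S_p = \begin{bmatrix} X_1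 & X_2\\ X_3 & X_4\end{bmatrix}\in \mathrm{Sp}(2p,\mathbb{R})$ and $S_q = \begin{bmatrix} Y_1 & Y_2\\ Y_3 & Y_4\end{bmatrix}\in \mathrm{Sp}(2q,\mathbb{R})$, and real numbers $\theta_1,\dots,\theta_q$ such that $$S = O\begin{bmatrix} H & 0\\ 0 & H^{-1}\end{bmatrix} f\left(\begin{bmatrix} S_p & 0\\ 0 & S_q\end{bmatrix}\right) = O \begin{bmatrix} Ch & 0 & Sh & & & \\ 0 & I_{p-q} & 0 & & & \\ Sh & 0 & Ch & & & \\ & & & Ch & 0 & -Sh\\ & & & 0 & I_{p-q} & 0\\ & & & -Sh & 0 & Ch\end{bmatrix}\begin{bmatrix} X_1 & 0 & X_2 & 0\\ 0 & Y_1 & 0 & Y_2\\ X_3 & 0 & X_4 & 0\\ 0 & Y_3 & 0 & Y_4\end{bmatrix}.$$ The numbers $\theta_1,\dots,\theta_q$ are unique up to permutation and sign: a vector $\theta'\in\mathbb{R}^q$ occurs in such a factorization of $S$ (with some $O$, $S_p$, $S_q$) if and only if there is a permutation $\sigma$ of $\{1,\dots,q\}$ with $\theta'_i = \pm\theta_{\sigma(i)}$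 for all $i$, the signs being independent of each other. -/

import Mathlib

open Matrix

/-- The `2n × 2n` permutation matrix `P_{p,q}` (`n = p + q`), with block rows of sizes `p, p, q, q`
and block columns of sizes `p, q, p, q`:
the block rows are `[I 0 0 0]`, `[0 0 I 0]`, `[0 I 0 0]`, `[0 0 0 I]`. -/
def permPQ (p q : ℕ) :
    Matrix ((Fin p ⊕ Fin p) ⊕ (Fin q ⊕ Fin q)) ((Fin p ⊕ Fin q) ⊕ (Fin p ⊕ Fin q)) ℝ :=
  fromBlocks (fromBlocks 1 0 0 0) (fromBlocks 0 0 1 0) (fromBlocks 0 1 0 0) (fromBlocks 0 0 0 1)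

/-- The map `f : A ↦ Pᵀ A P` with `P = P_{p,q}`. -/
def permConj (p q : ℕ)
    (A : Matrix ((Fin p ⊕ Fin p) ⊕ (Fin q ⊕ Fin q)) ((Fin p ⊕ Fin p) ⊕ (Fin q ⊕ Fin q)) ℝ) :
    Matrix ((Fin p ⊕ Fin q) ⊕ (Fin p ⊕ Fin q)) ((Fin p ⊕ Fin q) ⊕ (Fin p ⊕ Fin q)) ℝ :=
  (permPQ p q)ᵀ * A * permPQ p q

/-- For `q ≤ p` and `q`-vectors `c, s`, the `(p+q) × (p+q)` matrix
`[diag c, 0, diag s; 0, I, 0; diag s, 0, diag c]` with blocks of sizes `q, p - q, q`;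
the first two blocks together form the index type `Fin p`. -/
def threeBlock (p q : ℕ) (c s : Fin q → ℝ) : Matrix (Fin p ⊕ Fin q) (Fin p ⊕ Fin q) ℝ :=
  fromBlocks
    (diagonal fun i : Fin p => if h : i.val < q then c ⟨i.val, h⟩ else 1)
    (of fun (i : Fin p) (j : Fin q) => if i.val = j.val then s j else 0)
    (of fun (i : Fin q) (j : Fin p) => if i.val = j.val then s i else 0)
    (diagonal c)

/-- The hyperbolic block rotation `H = [Ch, 0, Sh; 0, I, 0; Sh, 0, Ch]`, where
`Ch = diag (cosh θ₁, …, cosh θ_q)` and `Sh = diag (sinh θ₁, …, sinh θ_q)`. -/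
noncomputable def hypRot (p q : ℕ) (θ : Fin q → ℝ) :
    Matrix (Fin p ⊕ Fin q) (Fin p ⊕ Fin q) ℝ :=
  threeBlock p q (fun i => Real.cosh (θ i)) (fun i => Real.sinh (θ i))

/-! ### Positive square roots, geometric means and a Mostow-type decomposition. -/

section SquareRoots

open scoped ComplexOrder

variable {𝕜 n : Type*} [RCLike 𝕜] [Fintype n] [DecidableEq n]

/-! Let D = diag(1, -1, 1, -1) with blocks p, q, p, q. The matrices f(diag(S_p, S_q)) are exactly
the symplectic matrices commuting with D, so the theorem is a decomposition S = O·diag(H, H⁻¹)·g in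
which g centralizes the involution D.

Existence. For positive definite matrices, being symplectic means being inverted under conjugation
by J. The geometric mean of M = SᵀS and DMD yields M = h N h with positive definite symplectic h and
N, where h commutes with D and D inverts N (`Matrix.PosDef.exists_mostow`). With N = B², the matrix
S h⁻¹ B⁻¹ is orthogonal symplectic, so only B needs a normal form. D and J both invert B, and after
a sign twist B becomes a complex positive matrix in U(p,q). A singular value decomposition of its
off-diagonal block gives B = k·diag(H, H⁻¹)·kᵀ with k orthogonal and commuting with J and D
(`Matrix.PosDef.exists_eq_conj_hypSymplectic`). Then k is absorbed into O on the left and kᵀ into g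
on the right.

Uniqueness. M⁻¹DMD + DM⁻¹DM loses O and changes only by similarity under g. It is similar to a
diagonal matrix with entries 2cosh 4θᵢ, each four times, and 2 elsewhere; its characteristic
polynomial determines the θᵢ up to order and sign. Conversely, signed permutation matrices in O(p) ×
O(q) realize every such change. -/

open scoped MatrixOrder Matrix.Norms.L2Operator in
theorem Matrix.PosSemidef.eq_of_mul_self_eq {A B : Matrix n n 𝕜} (hA : A.PosSemidef)
    (hB : B.PosSemidef) (h : A * A = B * B) : A = B := by
  rw [← CFC.sqrt_mul_self A hA.nonneg, h, CFC.sqrt_mul_self B hB.nonneg]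

open scoped MatrixOrder Matrix.Norms.L2Operator in
theorem Matrix.PosDef.exists_posDef_mul_self_eq {A : Matrix n n 𝕜} (hA : A.PosDef) :
    ∃ B : Matrix n n 𝕜, B.PosDef ∧ B * B = A := by
  refine ⟨CFC.sqrt A, ?_, CFC.sqrt_mul_sqrt_self A hA.posSemidef.nonneg⟩
  rw [← isStrictlyPositive_iff_posDef] at hA ⊢
  exact hA.sqrt

theorem Matrix.PosDef.mul_mul_self {A B : Matrix n n 𝕜} (hA : A.PosDef) (hB : B.PosDef) :
    (A * B * A).PosDef := by
  have := (IsUnit.posDef_star_left_conjugate_iff hA.isUnit (x := B)).2 hB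
  rwa [star_eq_conjTranspose, hA.isHermitian.eq] at this

theorem Matrix.PosDef.conj_of_mul_conjTranspose_eq_one {A g : Matrix n n 𝕜} (hA : A.PosDef)
    (hg : g * gᴴ = 1) : (g * A * gᴴ).PosDef := by
  have hu : IsUnit g := by
    rw [isUnit_iff_isUnit_det]
    exact isUnit_det_of_right_inverse hg
  exact (IsUnit.posDef_star_right_conjugate_iff hu (x := A)).2 hA

theorem Matrix.PosDef.mul_inv_cancel {A : Matrix n n 𝕜} (hA : A.PosDef) : A * A⁻¹ = 1 :=
  mul_nonsing_inv A ((isUnit_iff_isUnit_det A).1 hA.isUnit)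

theorem Matrix.PosDef.inv_mul_cancel {A : Matrix n n 𝕜} (hA : A.PosDef) : A⁻¹ * A = 1 :=
  nonsing_inv_mul A ((isUnit_iff_isUnit_det A).1 hA.isUnit)

/-- The Riccati equation `X M X = N` has at most one positive definite solution. -/
theorem Matrix.PosDef.eq_of_mul_mul_self_eq {M X Y : Matrix n n 𝕜} (hM : M.PosDef)
    (hX : X.PosDef) (hY : Y.PosDef) (h : X * M * X = Y * M * Y) : X = Y := by
  obtain ⟨E, hE, rfl⟩ := hM.exists_posDef_mul_self_eq
  have key : E * X * E = E * Y * E := by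
    refine (hE.mul_mul_self hX).posSemidef.eq_of_mul_self_eq (hE.mul_mul_self hY).posSemidef ?_
    calc E * X * E * (E * X * E) = E * (X * (E * E) * X) * E := by noncomm_ring
      _ = E * Y * E * (E * Y * E) := by rw [h]; noncomm_ring
  exact hE.isUnit.mul_left_cancel (hE.isUnit.mul_right_cancel key)

/-- Existence of the geometric mean of two positive definite matrices. -/
theorem Matrix.PosDef.exists_mul_inv_mul_eq {M N : Matrix n n 𝕜} (hM : M.PosDef)
    (hN : N.PosDef) : ∃ X : Matrix n n 𝕜, X.PosDef ∧ X * M⁻¹ * X = N := by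
  obtain ⟨E, hE, rfl⟩ := hM.exists_posDef_mul_self_eq
  obtain ⟨F, hF, hFF⟩ := (hE.inv.mul_mul_self hN).exists_posDef_mul_self_eq
  refine ⟨E * F * E, hE.mul_mul_self hF, ?_⟩
  have h1 := hE.mul_inv_cancel
  have h2 := hE.inv_mul_cancel
  calc E * F * E * (E * E)⁻¹ * (E * F * E)
      = E * F * (E * E⁻¹) * (E⁻¹ * E) * F * E := by rw [Matrix.mul_inv_rev]; noncomm_ring
    _ = E * (F * F) * E := by rw [h1, h2]; noncomm_ring
    _ = (E * E⁻¹) * N * (E⁻¹ * E) := by rw [hFF]; noncomm_ring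
    _ = N := by rw [h1, h2, one_mul, mul_one]

theorem Matrix.PosDef.inv_inv_eq {A : Matrix n n 𝕜} (hA : A.PosDef) : A⁻¹⁻¹ = A :=
  nonsing_inv_nonsing_inv _ ((isUnit_iff_isUnit_det A).1 hA.isUnit)

theorem isometryConj_mul {g : Matrix n n 𝕜} (hg : g * gᴴ = 1) (A B : Matrix n n 𝕜) :
    g * A * gᴴ * (g * B * gᴴ) = g * (A * B) * gᴴ := by
  have hg' : gᴴ * g = 1 := mul_eq_one_comm.1 hg
  calc g * A * gᴴ * (g * B * gᴴ) = g * A * (gᴴ * g) * B * gᴴ := by noncomm_ring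
    _ = _ := by rw [hg']; noncomm_ring

theorem isometryConj_inv {g : Matrix n n 𝕜} (hg : g * gᴴ = 1) (A : Matrix n n 𝕜) :
    (g * A * gᴴ)⁻¹ = g * A⁻¹ * gᴴ := by
  rw [Matrix.mul_inv_rev, Matrix.mul_inv_rev, inv_eq_left_inv hg, inv_eq_right_inv hg, mul_assoc]

/-- Both sides are positive semidefinite roots of the same matrix, so the symmetry passes from a
positive matrix to its root. -/
theorem Matrix.PosDef.conj_eq_inv_of_mul_self {A g : Matrix n n 𝕜} (hA : A.PosDef)
    (hg : g * gᴴ = 1) (h : g * (A * A) * gᴴ = (A * A)⁻¹) : g * A * gᴴ = A⁻¹ := by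
  refine (hA.conj_of_mul_conjTranspose_eq_one hg).posSemidef.eq_of_mul_self_eq
    hA.inv.posSemidef ?_
  rw [isometryConj_mul hg, h, Matrix.mul_inv_rev]

theorem Matrix.PosDef.conj_eq_self_of_mul_self {A g : Matrix n n 𝕜} (hA : A.PosDef)
    (hg : g * gᴴ = 1) (h : g * (A * A) * gᴴ = A * A) : g * A * gᴴ = A := by
  refine (hA.conj_of_mul_conjTranspose_eq_one hg).posSemidef.eq_of_mul_self_eq
    hA.posSemidef ?_
  rw [isometryConj_mul hg, h]

/-- A Mostow-type decomposition of a positive definite matrix `M` which is inverted by the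
isometry `j`, relative to an isometric involution `d` commuting with `j`. -/
theorem Matrix.PosDef.exists_mostow {M j d : Matrix n n 𝕜} (hM : M.PosDef)
    (hj : j * jᴴ = 1) (hd : d * d = 1) (hd' : dᴴ = d) (hjd : j * d = d * j)
    (hjM : j * M * jᴴ = M⁻¹) :
    ∃ h N : Matrix n n 𝕜, h.PosDef ∧ N.PosDef ∧ j * h * jᴴ = h⁻¹ ∧ d * h * d = h ∧
      j * N * jᴴ = N⁻¹ ∧ d * N * d = N⁻¹ ∧ M = h * N * h := by
  have hdd : d * dᴴ = 1 := by rw [hd', hd]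
  have hM' : (d * M * d).PosDef := by
    have := hM.conj_of_mul_conjTranspose_eq_one hdd
    rwa [hd'] at this
  have hdM' : (d * M * d)⁻¹ = d * M⁻¹ * d := by
    have := isometryConj_inv hdd M
    rwa [hd'] at this
  have hjd' : jᴴ * d = d * jᴴ := by
    have := congrArg star hjd
    simp only [star_eq_conjTranspose, conjTranspose_mul, hd'] at this
    exact this.symm
  -- The desired M = hNh forces dMd = hN⁻¹h = h²M⁻¹h², so h² has to be the geometric mean X of M and
  -- dMd. Its symmetries follow from uniqueness of the Riccati solution.
  obtain ⟨X, hX, hXM⟩ := hM.exists_mul_inv_mul_eq hM'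
  have hjMi : j * M⁻¹ * jᴴ = M := by
    rw [← isometryConj_inv hj, hjM, hM.inv_inv_eq]
  have hjX : j * X * jᴴ = X⁻¹ := by
    -- Conjugating the Riccati equation by j and inverting it give the same equation, solved by jXjᴴ
    -- and by X⁻¹ respectively.
    have h1 : j * X * jᴴ * M * (j * X * jᴴ) = (d * M * d)⁻¹ := by
      conv_lhs => rw [← hjMi, isometryConj_mul hj, isometryConj_mul hj, hXM]
      rw [hdM', ← hjM]
      calc j * (d * M * d) * jᴴ = j * d * M * (d * jᴴ) := by noncomm_ring
        _ = _ := by rw [hjd, ← hjd']; noncomm_ring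
    refine hM.eq_of_mul_mul_self_eq (hX.conj_of_mul_conjTranspose_eq_one hj) hX.inv ?_
    rw [h1, ← hXM, Matrix.mul_inv_rev, Matrix.mul_inv_rev,
      hM.inv_inv_eq, mul_assoc]
  have hdX : d * X * d = X := by
    have hc := hX.conj_of_mul_conjTranspose_eq_one hdd
    rw [hd'] at hc
    refine hM.inv.eq_of_mul_mul_self_eq hc hX ?_
    -- The geometric mean is symmetric: inverting the equation exchanges the roles of M and dMd.
    have h2 : X * (d * M⁻¹ * d) * X = M := by
      rw [← hdM', ← hXM, Matrix.mul_inv_rev, Matrix.mul_inv_rev,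
        hM.inv_inv_eq]
      calc X * (X⁻¹ * (M * X⁻¹)) * X = (X * X⁻¹) * M * (X⁻¹ * X) := by noncomm_ring
        _ = M := by rw [hX.mul_inv_cancel, hX.inv_mul_cancel, one_mul, mul_one]
    rw [hXM]
    calc d * X * d * M⁻¹ * (d * X * d) = d * (X * (d * M⁻¹ * d) * X) * d := by noncomm_ring
      _ = _ := by rw [h2]
  obtain ⟨h, hh, rfl⟩ := hX.exists_posDef_mul_self_eq
  have hjh := hh.conj_eq_inv_of_mul_self hj hjX
  have hdh : d * h * d = h := by
    have := hh.conj_eq_self_of_mul_self hdd (by rw [hd', hdX])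
    rwa [hd'] at this
  have hhi := hh.mul_inv_cancel
  have hih := hh.inv_mul_cancel
  have hdhi : d * h⁻¹ * d = h⁻¹ := by
    have := isometryConj_inv hdd h
    rw [hd', hdh] at this
    exact this.symm
  have hjhi : j * h⁻¹ * jᴴ = h := by
    rw [← isometryConj_inv hj, hjh, hh.inv_inv_eq]
  have hNinv : (h⁻¹ * M * h⁻¹)⁻¹ = h * M⁻¹ * h := by
    rw [Matrix.mul_inv_rev, Matrix.mul_inv_rev,
      hh.inv_inv_eq, mul_assoc]
  refine ⟨h, h⁻¹ * M * h⁻¹, hh, hh.inv.mul_mul_self hM, hjh, hdh, ?_, ?_, ?_⟩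
  · rw [hNinv, ← isometryConj_mul hj, ← isometryConj_mul hj, hjhi, hjM]
  · have h3 : d * (h⁻¹ * M * h⁻¹) * d = (d * h⁻¹ * d) * (d * M * d) * (d * h⁻¹ * d) := by
      calc d * (h⁻¹ * M * h⁻¹) * d = d * h⁻¹ * 1 * M * 1 * h⁻¹ * d := by noncomm_ring
        _ = _ := by rw [← hd]; noncomm_ring
    rw [hNinv, h3, hdhi, ← hXM]
    calc h⁻¹ * (h * h * M⁻¹ * (h * h)) * h⁻¹
        = (h⁻¹ * h) * h * M⁻¹ * h * (h * h⁻¹) := by noncomm_ring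
      _ = _ := by rw [hhi, hih, one_mul, mul_one]
  · calc M = (h * h⁻¹) * M * (h⁻¹ * h) := by rw [hhi, hih, one_mul, mul_one]
      _ = _ := by noncomm_ring

end SquareRoots

/-! ### Singular value decomposition. -/

section SVD

variable {ι κ : Type*} [Fintype ι] [DecidableEq ι] [Fintype κ] [DecidableEq κ]

open scoped ComplexOrder in
/-- Singular value decomposition of a complex matrix with at least as many rows as columns. -/
theorem Matrix.exists_singular_value_decomposition (e : κ ↪ ι) (W : Matrix ι κ ℂ) :
    ∃ U ∈ unitaryGroup ι ℂ, ∃ V ∈ unitaryGroup κ ℂ, ∃ s : κ → ℝ,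
      W * V = U * of fun i j => if i = e j then (s j : ℂ) else 0 := by
  have hpsd := posSemidef_conjTranspose_mul_self W
  obtain ⟨V, hV⟩ : ∃ V, V = hpsd.isHermitian.eigenvectorUnitary := ⟨_, rfl⟩
  set Z : Matrix ι κ ℂ := W * V.1 with hZ
  set s : κ → ℝ := fun j => √(hpsd.isHermitian.eigenvalues j) with hs
  have hss : ∀ j, s j * s j = hpsd.isHermitian.eigenvalues j := fun j =>
    Real.mul_self_sqrt (hpsd.eigenvalues_nonneg j)
  have hZZ : Zᴴ * Z = diagonal fun j => ((s j * s j : ℝ) : ℂ) := by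
    have := hpsd.isHermitian.conjStarAlgAut_star_eigenvectorUnitary
    rw [Unitary.conjStarAlgAut_star_apply, ← hV] at this
    rw [hZ, conjTranspose_mul, ← star_eq_conjTranspose V.1]
    simp only [hss]
    rw [Matrix.mul_assoc, ← Matrix.mul_assoc Wᴴ, ← Matrix.mul_assoc]
    exact this
  let z : κ → EuclideanSpace ℂ ι := fun j => WithLp.toLp 2 fun i => Z i j
  have hz : ∀ j k, inner ℂ (z j) (z k) = if j = k then ((s j * s j : ℝ) : ℂ) else 0 := by
    intro j k
    have := congrFun (congrFun hZZ j) k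
    rw [mul_apply, diagonal_apply] at this
    rw [← this]
    simp [z, PiLp.inner_apply, mul_comm]
  -- Normalized columns of WV, placed at the indices e j. Only those with s j ≠ 0 are kept; an
  -- orthonormal basis fills in the rest, and the other values of v are never used.
  let v : ι → EuclideanSpace ℂ ι := Function.extend e (fun j => ((s j : ℂ)⁻¹) • z j) 0
  have hv : Orthonormal ℂ ((e '' {j | s j ≠ 0}).domRestrict v) := by
    rw [orthonormal_iff_ite]
    rintro ⟨_, j, hj, rfl⟩ ⟨_, k, hk, rfl⟩
    have hj' : (s j : ℂ) ≠ 0 := by exact_mod_cast hj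
    have hk' : (s k : ℂ) ≠ 0 := by exact_mod_cast hk
    simp only [Set.domRestrict_apply, v, e.injective.extend_apply, inner_smul_left,
      inner_smul_right, hz]
    by_cases h : j = k
    · subst h
      simp [hj']
    · simp [h, Subtype.ext_iff]
  obtain ⟨b, hb⟩ := hv.exists_orthonormalBasis_extension_of_card_eq (by simp)
  refine ⟨of fun i j => b j i, ?_, V.1, V.2, s, ?_⟩
  · rw [mem_unitaryGroup_iff']
    ext j k
    have := orthonormal_iff_ite.1 b.orthonormal j k
    rw [star_eq_conjTranspose, mul_apply, one_apply, ← this]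
    simp [PiLp.inner_apply, mul_comm]
  · ext i j
    have hzj : z j = (s j : ℂ) • b (e j) := by
      by_cases h : s j = 0
      · have : inner ℂ (z j) (z j) = 0 := by rw [hz]; simp [h]
        rw [inner_self_eq_zero.1 this]
        simp [h]
      · rw [hb _ ⟨j, h, rfl⟩]
        have h' : (s j : ℂ) ≠ 0 := by exact_mod_cast h
        simp [v, e.injective.extend_apply, smul_smul, h']
    have := congrArg (fun x : EuclideanSpace ℂ ι => x i) hzj
    simp only [z, PiLp.smul_apply, smul_eq_mul] at this
    rw [← hZ, this, mul_apply]
    simp [mul_comm]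

end SVD

/-! ### Algebra of hyperbolic block rotations. -/

section ThreeBlock

variable {p q : ℕ}

theorem sum_ite_val_eq {R : Type*} [AddCommMonoid R] (i : Fin p) (f : Fin q → R) :
    (∑ k : Fin q, if i.val = k.val then f k else 0) =
      if h : i.val < q then f ⟨i.val, h⟩ else 0 := by
  split_ifs with h
  · rw [Finset.sum_eq_single ⟨i.val, h⟩]
    · simp
    · intro k _ hk
      rw [if_neg]
      rintro h'
      exact hk (Fin.ext h'.symm)
    · simp
  · refine Finset.sum_eq_zero fun k _ => if_neg ?_
    have := k.2
    omega

theorem sum_ite_val_eq' {R : Type*} [AddCommMonoid R] (hqp : q ≤ p) (i : Fin q) (f : Fin p → R) :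
    (∑ k : Fin p, if i.val = k.val then f k else 0) = f (Fin.castLE hqp i) := by
  rw [sum_ite_val_eq, dif_pos (i.2.trans_le hqp)]
  rfl

/-- Each pair of coupled coordinates multiplies like split-complex numbers c + s·ε with ε² = 1; the
uncoupled coordinates stay fixed. -/
theorem threeBlock_mul (hqp : q ≤ p) (c s c' s' : Fin q → ℝ) :
    threeBlock p q c s * threeBlock p q c' s' =
      threeBlock p q (fun i => c i * c' i + s i * s' i) (fun i => c i * s' i + s i * c' i) := by
  rw [threeBlock, threeBlock, fromBlocks_multiply, threeBlock]
  congr 1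
  · ext i j
    rw [Matrix.add_apply, diagonal_mul_diagonal, mul_apply]
    simp only [of_apply, ite_mul, zero_mul]
    rw [sum_ite_val_eq]
    by_cases hij : i = j
    · subst hij
      by_cases h : i.val < q <;> simp [h]
    · have : i.val ≠ j.val := fun h => hij (Fin.ext h)
      by_cases h : i.val < q <;> simp [h, hij, this]
  · ext i j
    rw [Matrix.add_apply, diagonal_mul, mul_diagonal]
    simp only [of_apply]
    by_cases hij : i.val = j.val
    · simp [hij]
    · simp [hij]
  · ext i j
    rw [Matrix.add_apply, diagonal_mul, mul_diagonal]
    simp only [of_apply]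
    by_cases hij : i.val = j.val
    · simp [← hij]; ring
    · simp [hij]
  · ext i j
    rw [Matrix.add_apply, diagonal_mul_diagonal, mul_apply]
    simp only [of_apply, ite_mul, zero_mul]
    rw [sum_ite_val_eq' hqp]
    by_cases hij : i = j
    · subst hij
      simp; ring
    · have : i.val ≠ j.val := fun h => hij (Fin.ext h)
      simp [hij, this]

theorem threeBlock_one_zero : threeBlock p q (fun _ => 1) (fun _ => 0) = 1 := by
  rw [threeBlock, ← fromBlocks_one]
  congr 1
  · ext i j
    simp [diagonal_apply, one_apply]
  · ext i j
    simp
  · ext i j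
    simp

theorem threeBlock_transpose (c s : Fin q → ℝ) :
    (threeBlock p q c s)ᵀ = threeBlock p q c s := by
  rw [threeBlock, fromBlocks_transpose, diagonal_transpose, diagonal_transpose]
  congr 1
  · ext i j
    by_cases h : i.val = j.val
    · simp [h]
    · simp [h, Ne.symm h]
  · ext i j
    by_cases h : i.val = j.val
    · simp [h]
    · simp [h, Ne.symm h]

/-- The signature matrix `diag (1, -1)`. -/
def signature (ι κ R : Type*) [DecidableEq ι] [DecidableEq κ] [Ring R] :
    Matrix (ι ⊕ κ) (ι ⊕ κ) R :=
  fromBlocks 1 0 0 (-1)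

theorem signature_mul_self (ι κ R : Type*) [Fintype ι] [Fintype κ] [DecidableEq ι]
    [DecidableEq κ] [Ring R] : signature ι κ R * signature ι κ R = 1 := by
  simp [signature, fromBlocks_multiply]

theorem signature_transpose (ι κ R : Type*) [DecidableEq ι]
    [DecidableEq κ] [Ring R] : (signature ι κ R)ᵀ = signature ι κ R := by
  simp [signature, fromBlocks_transpose]

theorem signature_mul_threeBlock_mul_signature (c s : Fin q → ℝ) :
    signature (Fin p) (Fin q) ℝ * threeBlock p q c s * signature (Fin p) (Fin q) ℝ =
      threeBlock p q c (fun i => -s i) := by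
  rw [signature, threeBlock, fromBlocks_multiply, fromBlocks_multiply, threeBlock]
  congr 1
  · simp
  · ext i j
    by_cases h : i.val = j.val <;> simp [h]
  · ext i j
    by_cases h : i.val = j.val <;> simp [h]
  · simp

theorem hypRot_mul_hypRot (hqp : q ≤ p) (θ η : Fin q → ℝ) :
    hypRot p q θ * hypRot p q η = hypRot p q (θ + η) := by
  rw [hypRot, hypRot, threeBlock_mul hqp, hypRot]
  congr 1
  · ext i
    rw [Pi.add_apply, Real.cosh_add]
  · ext i
    rw [Pi.add_apply, Real.sinh_add]
    ring

theorem hypRot_zero : hypRot p q 0 = 1 := by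
  simp [hypRot, threeBlock_one_zero]

theorem hypRot_neg (θ : Fin q → ℝ) :
    hypRot p q (-θ) = signature (Fin p) (Fin q) ℝ * hypRot p q θ * signature (Fin p) (Fin q) ℝ := by
  rw [hypRot, hypRot, signature_mul_threeBlock_mul_signature]
  simp

theorem hypRot_mul_neg (hqp : q ≤ p) (θ : Fin q → ℝ) : hypRot p q θ * hypRot p q (-θ) = 1 := by
  rw [hypRot_mul_hypRot hqp, add_neg_cancel, hypRot_zero]

theorem hypRot_inv (hqp : q ≤ p) (θ : Fin q → ℝ) : (hypRot p q θ)⁻¹ = hypRot p q (-θ) :=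
  inv_eq_right_inv (hypRot_mul_neg hqp θ)

theorem hypRot_transpose (θ : Fin q → ℝ) : (hypRot p q θ)ᵀ = hypRot p q θ :=
  threeBlock_transpose _ _

theorem hypRot_mul_signature_mul_hypRot (hqp : q ≤ p) (θ : Fin q → ℝ) :
    hypRot p q θ * signature (Fin p) (Fin q) ℝ * hypRot p q θ = signature (Fin p) (Fin q) ℝ := by
  have h := hypRot_mul_neg hqp θ
  rw [hypRot_neg] at h
  calc _ = hypRot p q θ * (signature (Fin p) (Fin q) ℝ * hypRot p q θ *
        signature (Fin p) (Fin q) ℝ) * signature (Fin p) (Fin q) ℝ := by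
        simp only [mul_assoc, signature_mul_self, mul_one]
    _ = _ := by rw [h, one_mul]

end ThreeBlock

/-! ### Normal form of positive matrices in U(p,q). -/

section ComplexNormalForm

variable {p q : ℕ}

theorem signature_map_ofReal (ι κ : Type*) [DecidableEq ι] [DecidableEq κ] :
    (signature ι κ ℝ).map Complex.ofReal = signature ι κ ℂ := by
  rw [signature, fromBlocks_map, signature]
  congr 1 <;> simp [Matrix.map_one, Matrix.map_neg]

/-- The hyperbolic block rotation with complex entries. -/
noncomputable def hypRotC (p q : ℕ) (θ : Fin q → ℝ) : Matrix (Fin p ⊕ Fin q) (Fin p ⊕ Fin q) ℂ :=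
  (hypRot p q θ).map Complex.ofReal

theorem hypRotC_mul_signature_mul_hypRotC (hqp : q ≤ p) (θ : Fin q → ℝ) :
    hypRotC p q θ * signature (Fin p) (Fin q) ℂ * hypRotC p q θ = signature (Fin p) (Fin q) ℂ := by
  have := congrArg (fun A => A.map (Complex.ofRealHom : ℝ →+* ℂ))
    (hypRot_mul_signature_mul_hypRot hqp θ)
  simp only [Matrix.map_mul] at this
  rw [← signature_map_ofReal]
  exact this

-- For B = [P, W; Wᴴ, Q], the signature relation gives P² = 1 + WWᴴ and Q² = 1 + WᴴW. Positivity
-- therefore makes W determine P and Q, and a singular value decomposition of W brings all blocks to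
-- normal form at once.
open scoped ComplexOrder in
theorem Matrix.PosSemidef.exists_blockUnitary_hypRotC (hqp : q ≤ p)
    {B : Matrix (Fin p ⊕ Fin q) (Fin p ⊕ Fin q) ℂ} (hB : B.PosSemidef)
    (hsig : B * signature (Fin p) (Fin q) ℂ * B = signature (Fin p) (Fin q) ℂ) :
    ∃ U ∈ unitaryGroup (Fin p) ℂ, ∃ V ∈ unitaryGroup (Fin q) ℂ, ∃ θ : Fin q → ℝ,
      B = fromBlocks U 0 0 V * hypRotC p q θ * (fromBlocks U 0 0 V)ᴴ := by
  obtain ⟨P, W, W', Q, rfl⟩ : ∃ P W W' Q, B = fromBlocks P W W' Q :=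
    ⟨_, _, _, _, (fromBlocks_toBlocks B).symm⟩
  have hP : P.PosSemidef := hB.submatrix Sum.inl
  have hQ : Q.PosSemidef := hB.submatrix Sum.inr
  obtain ⟨-, hW, -, -⟩ := isHermitian_fromBlocks_iff.1 hB.isHermitian
  subst hW
  obtain ⟨U, hU, V, hV, s, hWV⟩ := W.exists_singular_value_decomposition (Fin.castLEEmb hqp)
  have hUU := mem_unitaryGroup_iff.1 hU
  have hUU' := mem_unitaryGroup_iff'.1 hU
  have hVV := mem_unitaryGroup_iff.1 hV
  have hVV' := mem_unitaryGroup_iff'.1 hV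
  rw [star_eq_conjTranspose] at hUU hVV hUU' hVV'
  -- The off-diagonal block of H must carry the singular values, so sinh θⱼ = sⱼ.
  refine ⟨U, hU, V, hV, fun j => Real.arsinh (s j), ?_⟩
  set θ := fun j => Real.arsinh (s j) with hθ
  have hH := hypRotC_mul_signature_mul_hypRotC hqp θ
  set R : Matrix (Fin p) (Fin q) ℂ := of fun i j => if i = Fin.castLEEmb hqp j then (s j : ℂ) else 0
    with hR
  set cp : Fin p → ℂ := fun i => if h : i.val < q then (Real.cosh (θ ⟨i, h⟩) : ℂ) else 1 with hcp
  set cq : Fin q → ℂ := fun i => (Real.cosh (θ i) : ℂ) with hcq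
  have hHb : hypRotC p q θ = fromBlocks (diagonal cp) R Rᴴ (diagonal cq) := by
    rw [hypRotC, hypRot, threeBlock, fromBlocks_map, diagonal_map, diagonal_map]
    · congr 1
      · congr 1
        ext i
        by_cases h : i.val < q <;> simp [hcp, h]
      · ext i j
        by_cases h : i.val = j.val <;> simp [hR, hθ, Fin.ext_iff, h]
      · ext i j
        by_cases h : i.val = j.val
        · simp [hR, hθ, Fin.ext_iff, h]
        · simp [hR, hθ, Fin.ext_iff, h, Ne.symm h]
    · simp
    · simp
  have hW : W = U * R * Vᴴ := by rw [← hWV, Matrix.mul_assoc, hVV, Matrix.mul_one]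
  have hWh : Wᴴ = V * Rᴴ * Uᴴ := by
    rw [hW, conjTranspose_mul, conjTranspose_mul, conjTranspose_conjTranspose, Matrix.mul_assoc]
  rw [hHb, signature, fromBlocks_multiply, fromBlocks_multiply, fromBlocks_inj] at hH
  rw [signature, fromBlocks_multiply, fromBlocks_multiply, fromBlocks_inj] at hsig
  obtain ⟨hH1, -, -, hH2⟩ := hH
  obtain ⟨hs1, -, -, hs2⟩ := hsig
  simp only [Matrix.mul_one, Matrix.mul_zero, add_zero, zero_add, Matrix.mul_neg,
    Matrix.neg_mul] at hH1 hH2 hs1 hs2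
  have hcp0 : (diagonal cp).PosSemidef := by
    refine PosSemidef.diagonal fun i => ?_
    by_cases h : i.val < q
    · simp only [hcp, h, dif_pos, Pi.zero_apply]
      exact_mod_cast (Real.cosh_pos _).le
    · simp [hcp, h]
  have hcq0 : (diagonal cq).PosSemidef := by
    refine PosSemidef.diagonal fun i => ?_
    simp only [hcq, Pi.zero_apply]
    exact_mod_cast (Real.cosh_pos _).le
  have hPeq : P = U * diagonal cp * Uᴴ := by
    refine hP.eq_of_mul_self_eq (hcp0.mul_mul_conjTranspose_same U) ?_
    rw [isometryConj_mul hUU, eq_add_of_add_neg_eq hs1, eq_add_of_add_neg_eq hH1, hWh, hW,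
      Matrix.mul_add, Matrix.add_mul, Matrix.mul_one, hUU]
    congr 1
    simp only [Matrix.mul_assoc]
    rw [← Matrix.mul_assoc Vᴴ V, hVV', Matrix.one_mul]
  have hQeq : Q = V * diagonal cq * Vᴴ := by
    refine hQ.eq_of_mul_self_eq (hcq0.mul_mul_conjTranspose_same V) ?_
    have h1 : Q * Q = 1 + Wᴴ * W := by rw [← sub_eq_zero, ← neg_eq_zero, ← sub_eq_zero.2 hs2]; abel
    have h2 : diagonal cq * diagonal cq = 1 + Rᴴ * R := by
      rw [← sub_eq_zero, ← neg_eq_zero, ← sub_eq_zero.2 hH2]; abel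
    rw [isometryConj_mul hVV, h1, h2, hWh, hW,
      Matrix.mul_add, Matrix.add_mul, Matrix.mul_one, hVV]
    congr 1
    simp only [Matrix.mul_assoc]
    rw [← Matrix.mul_assoc Uᴴ U, hUU', Matrix.one_mul]
  rw [hHb, fromBlocks_conjTranspose, fromBlocks_multiply, fromBlocks_multiply]
  simp only [Matrix.mul_zero, Matrix.zero_mul, add_zero, zero_add, conjTranspose_zero]
  rw [← hPeq, ← hQeq, ← hW, ← hWh]

end ComplexNormalForm

/-! ### Complex matrices as real matrices commuting with J. -/

section Realification

variable {n : Type*}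

/-- The real matrix `[Re A, -Im A; Im A, Re A]` of a complex matrix `A`. -/
def realify (A : Matrix n n ℂ) : Matrix (n ⊕ n) (n ⊕ n) ℝ :=
  fromBlocks (A.map Complex.re) (-A.map Complex.im) (A.map Complex.im) (A.map Complex.re)

theorem realify_one [DecidableEq n] : realify (1 : Matrix n n ℂ) = 1 := by
  rw [realify, ← fromBlocks_one]
  congr 1 <;> ext i j <;> by_cases h : i = j <;> simp [h, one_apply]

theorem realify_mul [Fintype n] (A B : Matrix n n ℂ) : realify (A * B) = realify A * realify B := by
  rw [realify, realify, realify, fromBlocks_multiply]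
  congr 1 <;> ext i j <;>
    simp [mul_apply, Finset.sum_add_distrib, sub_eq_add_neg, add_comm]

theorem realify_conjTranspose (A : Matrix n n ℂ) : realify Aᴴ = (realify A)ᵀ := by
  rw [realify, realify, fromBlocks_transpose]
  congr 1
  all_goals
    ext i j
    simp

theorem realify_injective : Function.Injective (realify : Matrix n n ℂ → _) := by
  intro A B h
  rw [realify, realify, fromBlocks_inj] at h
  ext i j
  exact Complex.ext (congrFun (congrFun h.1 i) j) (congrFun (congrFun h.2.2.1 i) j)

theorem realify_map_ofReal (A : Matrix n n ℝ) :
    realify (A.map Complex.ofReal) = fromBlocks A 0 0 A := by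
  rw [realify]
  congr 1
  all_goals
    ext i j
    simp

/-- A real matrix commuting with the complex structure `J` comes from a complex matrix. -/
theorem exists_realify_eq [Fintype n] [DecidableEq n] {Z : Matrix (n ⊕ n) (n ⊕ n) ℝ}
    (h : J n ℝ * Z = Z * J n ℝ) :
    ∃ A, realify A = Z := by
  obtain ⟨a, b, c, d, rfl⟩ : ∃ a b c d, Z = fromBlocks a b c d :=
    ⟨_, _, _, _, (fromBlocks_toBlocks Z).symm⟩
  rw [J, fromBlocks_multiply, fromBlocks_multiply, fromBlocks_inj] at h
  obtain ⟨h1, h2, -, -⟩ := h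
  simp only [zero_mul, neg_mul, one_mul, zero_add, mul_zero, mul_one, mul_neg, add_zero,
    neg_inj] at h1 h2
  refine ⟨of fun i j => ⟨a i j, c i j⟩, ?_⟩
  subst h2
  rw [realify, ← neg_eq_iff_eq_neg.2 h1.symm]
  congr 1
  ext i j
  simp

end Realification

/-! ### The block shuffle f and symplecticity. -/

section PermConj

variable {p q : ℕ}

theorem permPQ_mul_transpose : permPQ p q * (permPQ p q)ᵀ = 1 := by
  simp [permPQ, fromBlocks_transpose, fromBlocks_multiply, fromBlocks_add]

theorem permConj_mul (A B : Matrix ((Fin p ⊕ Fin p) ⊕ (Fin q ⊕ Fin q))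
    ((Fin p ⊕ Fin p) ⊕ (Fin q ⊕ Fin q)) ℝ) :
    permConj p q A * permConj p q B = permConj p q (A * B) := by
  simp only [permConj, Matrix.mul_assoc]
  rw [← Matrix.mul_assoc (permPQ p q) (permPQ p q)ᵀ, permPQ_mul_transpose, Matrix.one_mul]

theorem permConj_transpose (A : Matrix ((Fin p ⊕ Fin p) ⊕ (Fin q ⊕ Fin q))
    ((Fin p ⊕ Fin p) ⊕ (Fin q ⊕ Fin q)) ℝ) : permConj p q Aᵀ = (permConj p q A)ᵀ := by
  simp only [permConj, Matrix.transpose_mul, Matrix.transpose_transpose, Matrix.mul_assoc]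

theorem permConj_injective : Function.Injective (permConj p q) := by
  have key : ∀ A, permPQ p q * permConj p q A * (permPQ p q)ᵀ = A := fun A => by
    simp only [permConj, Matrix.mul_assoc]
    rw [permPQ_mul_transpose, Matrix.mul_one, ← Matrix.mul_assoc, permPQ_mul_transpose,
      Matrix.one_mul]
  intro A B h
  rw [← key A, h, key]

theorem permConj_fromBlocks (A : Matrix (Fin p ⊕ Fin p) (Fin p ⊕ Fin p) ℝ)
    (B : Matrix (Fin q ⊕ Fin q) (Fin q ⊕ Fin q) ℝ) :
    permConj p q (fromBlocks A 0 0 B) =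
      fromBlocks
        (fromBlocks A.toBlocks₁₁ 0 0 B.toBlocks₁₁) (fromBlocks A.toBlocks₁₂ 0 0 B.toBlocks₁₂)
        (fromBlocks A.toBlocks₂₁ 0 0 B.toBlocks₂₁) (fromBlocks A.toBlocks₂₂ 0 0 B.toBlocks₂₂) := by
  conv_lhs => rw [← fromBlocks_toBlocks A, ← fromBlocks_toBlocks B]
  simp [permConj, permPQ, fromBlocks_transpose, fromBlocks_multiply, fromBlocks_add]

theorem permConj_J : permConj p q (fromBlocks (J (Fin p) ℝ) 0 0 (J (Fin q) ℝ)) =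
    J (Fin p ⊕ Fin q) ℝ := by
  rw [permConj_fromBlocks, J, J, J]
  simp only [toBlocks_fromBlocks₁₁, toBlocks_fromBlocks₁₂, toBlocks_fromBlocks₂₁,
    toBlocks_fromBlocks₂₂]
  rw [fromBlocks_zero, fromBlocks_one, ← fromBlocks_one, fromBlocks_neg, neg_zero, neg_zero]

/-- f is injective, multiplicative, compatible with transposes, and sends diag(J_p, J_q) to J_n, so
the symplectic relation splits blockwise. -/
theorem permConj_mem_symplecticGroup_iff {A : Matrix (Fin p ⊕ Fin p) (Fin p ⊕ Fin p) ℝ}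
    {B : Matrix (Fin q ⊕ Fin q) (Fin q ⊕ Fin q) ℝ} :
    permConj p q (fromBlocks A 0 0 B) ∈ symplecticGroup (Fin p ⊕ Fin q) ℝ ↔
      A ∈ symplecticGroup (Fin p) ℝ ∧ B ∈ symplecticGroup (Fin q) ℝ := by
  rw [SymplecticGroup.mem_iff, SymplecticGroup.mem_iff, SymplecticGroup.mem_iff, ← permConj_J,
    ← permConj_transpose, permConj_mul, permConj_mul, permConj_injective.eq_iff,
    fromBlocks_transpose, fromBlocks_multiply, fromBlocks_multiply, fromBlocks_inj]
  simp

end PermConj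

/-! ### The involution D, its centralizer, and the sign twist. -/

section DoubledSignature

variable {p q : ℕ}

/-- The doubled signature matrix `diag (1, -1, 1, -1)`. -/
def signature₂ (ι κ : Type*) [DecidableEq ι] [DecidableEq κ] :
    Matrix ((ι ⊕ κ) ⊕ (ι ⊕ κ)) ((ι ⊕ κ) ⊕ (ι ⊕ κ)) ℝ :=
  fromBlocks (signature ι κ ℝ) 0 0 (signature ι κ ℝ)

/-- The matrix `diag (1, 1, 1, -1)`, conjugation by which twists the complex structure. -/
def signatureTwist (ι κ : Type*) [DecidableEq ι] [DecidableEq κ] :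
    Matrix ((ι ⊕ κ) ⊕ (ι ⊕ κ)) ((ι ⊕ κ) ⊕ (ι ⊕ κ)) ℝ :=
  fromBlocks 1 0 0 (signature ι κ ℝ)

theorem signature₂_transpose (ι κ : Type*) [DecidableEq ι] [DecidableEq κ] :
    (signature₂ ι κ)ᵀ = signature₂ ι κ := by
  simp [signature₂, fromBlocks_transpose, signature_transpose]

theorem signatureTwist_transpose (ι κ : Type*) [DecidableEq ι] [DecidableEq κ] :
    (signatureTwist ι κ)ᵀ = signatureTwist ι κ := by
  simp [signatureTwist, fromBlocks_transpose, signature_transpose]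

section

variable (ι κ : Type*) [Fintype ι] [Fintype κ] [DecidableEq ι] [DecidableEq κ]

theorem signature₂_mul_self : signature₂ ι κ * signature₂ ι κ = 1 := by
  simp [signature₂, fromBlocks_multiply, signature_mul_self]

theorem J_mul_signature₂ : J (ι ⊕ κ) ℝ * signature₂ ι κ = signature₂ ι κ * J (ι ⊕ κ) ℝ := by
  simp [signature₂, J, fromBlocks_multiply]

theorem signatureTwist_mul_self : signatureTwist ι κ * signatureTwist ι κ = 1 := by
  simp [signatureTwist, fromBlocks_multiply, signature_mul_self]

theorem signatureTwist_mul_signature₂ :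
    signatureTwist ι κ * signature₂ ι κ = signature₂ ι κ * signatureTwist ι κ := by
  simp [signatureTwist, signature₂, fromBlocks_multiply]

/-- The twist turns commuting with DJ into commuting with J, which makes `exists_realify_eq`
applicable. -/
theorem signatureTwist_mul_J_mul_signatureTwist :
    signatureTwist ι κ * J (ι ⊕ κ) ℝ * signatureTwist ι κ = signature₂ ι κ * J (ι ⊕ κ) ℝ := by
  simp [signatureTwist, signature₂, J, fromBlocks_multiply]

end

theorem signature₂_eq_permConj :
    signature₂ (Fin p) (Fin q) = permConj p q (fromBlocks 1 0 0 (-1)) := by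
  rw [permConj_fromBlocks, signature₂, signature]
  have h1 : (1 : Matrix (Fin p ⊕ Fin p) (Fin p ⊕ Fin p) ℝ) = fromBlocks 1 0 0 1 :=
    fromBlocks_one.symm
  have h2 : (-1 : Matrix (Fin q ⊕ Fin q) (Fin q ⊕ Fin q) ℝ) = fromBlocks (-1) 0 0 (-1) := by
    rw [← fromBlocks_one, fromBlocks_neg, neg_zero]
  rw [h1, h2]
  simp only [toBlocks_fromBlocks₁₁, toBlocks_fromBlocks₁₂, toBlocks_fromBlocks₂₁,
    toBlocks_fromBlocks₂₂, fromBlocks_zero]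

theorem permConj_mul_signature₂ (A : Matrix (Fin p ⊕ Fin p) (Fin p ⊕ Fin p) ℝ)
    (B : Matrix (Fin q ⊕ Fin q) (Fin q ⊕ Fin q) ℝ) :
    permConj p q (fromBlocks A 0 0 B) * signature₂ (Fin p) (Fin q) =
      signature₂ (Fin p) (Fin q) * permConj p q (fromBlocks A 0 0 B) := by
  rw [signature₂_eq_permConj, permConj_mul, permConj_mul]
  simp [fromBlocks_multiply]

theorem exists_fromBlocks_eq_of_mul_signature {A : Matrix (Fin p ⊕ Fin q) (Fin p ⊕ Fin q) ℝ}
    (h : A * signature (Fin p) (Fin q) ℝ = signature (Fin p) (Fin q) ℝ * A) :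
    ∃ a b, A = fromBlocks a 0 0 b := by
  obtain ⟨a, b, c, d, rfl⟩ : ∃ a b c d, A = fromBlocks a b c d :=
    ⟨_, _, _, _, (fromBlocks_toBlocks A).symm⟩
  rw [signature, fromBlocks_multiply, fromBlocks_multiply, fromBlocks_inj] at h
  obtain ⟨-, h1, h2, -⟩ := h
  simp only [Matrix.mul_one, Matrix.mul_zero, add_zero, zero_add, Matrix.mul_neg,
    Matrix.neg_mul, Matrix.one_mul, Matrix.zero_mul] at h1 h2
  have hb : b = 0 := ext fun i j => neg_eq_self.1 (congrFun (congrFun h1 i) j)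
  have hc : c = 0 := ext fun i j => neg_eq_self.1 (congrFun (congrFun h2 i) j).symm
  exact ⟨a, d, by rw [hb, hc]⟩

/-- Commuting with D kills every entry joining a p-index to a q-index. With
`permConj_mul_signature₂`, this identifies the centralizer of D with the image under f of the block
diagonal matrices. -/
theorem exists_permConj_eq
    {g : Matrix ((Fin p ⊕ Fin q) ⊕ (Fin p ⊕ Fin q)) ((Fin p ⊕ Fin q) ⊕ (Fin p ⊕ Fin q)) ℝ}
    (h : g * signature₂ (Fin p) (Fin q) = signature₂ (Fin p) (Fin q) * g) :
    ∃ A B, g = permConj p q (fromBlocks A 0 0 B) := by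
  obtain ⟨a, b, c, d, rfl⟩ : ∃ a b c d, g = fromBlocks a b c d :=
    ⟨_, _, _, _, (fromBlocks_toBlocks g).symm⟩
  rw [signature₂, fromBlocks_multiply, fromBlocks_multiply, fromBlocks_inj] at h
  simp only [Matrix.mul_zero, add_zero, zero_add, Matrix.zero_mul] at h
  obtain ⟨a₁, a₂, rfl⟩ := exists_fromBlocks_eq_of_mul_signature h.1
  obtain ⟨b₁, b₂, rfl⟩ := exists_fromBlocks_eq_of_mul_signature h.2.1
  obtain ⟨c₁, c₂, rfl⟩ := exists_fromBlocks_eq_of_mul_signature h.2.2.1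
  obtain ⟨d₁, d₂, rfl⟩ := exists_fromBlocks_eq_of_mul_signature h.2.2.2
  refine ⟨fromBlocks a₁ b₁ c₁ d₁, fromBlocks a₂ b₂ c₂ d₂, ?_⟩
  rw [permConj_fromBlocks]
  simp

end DoubledSignature

/-! ### Positive definite and orthogonal symplectic matrices. -/

section Symplectic

variable {l : Type*} [Fintype l] [DecidableEq l]

theorem symplecticGroup_inv_mem {A : Matrix (l ⊕ l) (l ⊕ l) ℝ} (hA : A ∈ symplecticGroup l ℝ) :
    A⁻¹ ∈ symplecticGroup l ℝ := by
  have := (⟨A, hA⟩ : symplecticGroup l ℝ)⁻¹.2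
  rwa [SymplecticGroup.coe_inv'] at this

theorem J_mul_conjTranspose_J : J l ℝ * (J l ℝ)ᴴ = 1 := by
  rw [conjTranspose_eq_transpose_of_trivial, J_transpose, mul_neg, J_squared, neg_neg]

/-- For symmetric A the symplectic relation reads AJA = J. The inversion form is the one inherited
by square roots and geometric means. -/
theorem J_conj_eq_inv_iff {A : Matrix (l ⊕ l) (l ⊕ l) ℝ} (hA : A.PosDef) :
    J l ℝ * A * (J l ℝ)ᴴ = A⁻¹ ↔ A ∈ symplecticGroup l ℝ := by
  have hJ := J_squared l ℝ
  have hAt : Aᵀ = A := by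
    rw [← conjTranspose_eq_transpose_of_trivial]; exact hA.isHermitian
  rw [SymplecticGroup.mem_iff, hAt, conjTranspose_eq_transpose_of_trivial, J_transpose]
  constructor
  · intro h
    have h1 : J l ℝ * A * -J l ℝ * A = 1 := by rw [h, hA.inv_mul_cancel]
    calc A * J l ℝ * A = -(J l ℝ * J l ℝ) * (A * J l ℝ * A) := by rw [hJ]; simp
      _ = J l ℝ * (J l ℝ * A * -J l ℝ * A) := by noncomm_ring
      _ = J l ℝ := by rw [h1, mul_one]
  · intro h
    refine (inv_eq_left_inv ?_).symm
    calc J l ℝ * A * -J l ℝ * A = -(J l ℝ * (A * J l ℝ * A)) := by noncomm_ring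
      _ = 1 := by rw [h, hJ, neg_neg]

theorem mem_symplecticGroup_of_orthogonal {k : Matrix (l ⊕ l) (l ⊕ l) ℝ} (hk : k * kᵀ = 1)
    (hJ : k * J l ℝ = J l ℝ * k) : k ∈ symplecticGroup l ℝ := by
  rw [SymplecticGroup.mem_iff, hJ, mul_assoc, hk, mul_one]

end Symplectic

/-! ### Existence of the factorization. -/

section Existence

variable {p q : ℕ}

/-- The symplectic matrix `diag (H, H⁻¹)`. -/
noncomputable def hypSymplectic (p q : ℕ) (θ : Fin q → ℝ) :
    Matrix ((Fin p ⊕ Fin q) ⊕ (Fin p ⊕ Fin q)) ((Fin p ⊕ Fin q) ⊕ (Fin p ⊕ Fin q)) ℝ :=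
  fromBlocks (hypRot p q θ) 0 0 (hypRot p q (-θ))

/-- Realifying a real matrix duplicates it, and the twist conjugates the second copy of H by the
signature, which inverts it. -/
theorem signatureTwist_mul_realify_hypRotC (θ : Fin q → ℝ) :
    signatureTwist (Fin p) (Fin q) * realify (hypRotC p q θ) * signatureTwist (Fin p) (Fin q) =
      hypSymplectic p q θ := by
  rw [hypRotC, realify_map_ofReal, hypSymplectic, hypRot_neg]
  simp [signatureTwist, fromBlocks_multiply]

theorem realify_signature :
    realify (signature (Fin p) (Fin q) ℂ) = signature₂ (Fin p) (Fin q) := by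
  rw [← signature_map_ofReal, realify_map_ofReal, signature₂]

open scoped ComplexOrder in
/-- A positive definite symplectic matrix inverted by the doubled signature is a hyperbolic block
rotation in suitable coordinates. -/
theorem Matrix.PosDef.exists_eq_conj_hypSymplectic (hqp : q ≤ p)
    {B : Matrix ((Fin p ⊕ Fin q) ⊕ (Fin p ⊕ Fin q)) ((Fin p ⊕ Fin q) ⊕ (Fin p ⊕ Fin q)) ℝ}
    (hB : B.PosDef) (hJ : J (Fin p ⊕ Fin q) ℝ * B * (J (Fin p ⊕ Fin q) ℝ)ᴴ = B⁻¹)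
    (hD : signature₂ (Fin p) (Fin q) * B * signature₂ (Fin p) (Fin q) = B⁻¹) :
    ∃ k : Matrix ((Fin p ⊕ Fin q) ⊕ (Fin p ⊕ Fin q)) ((Fin p ⊕ Fin q) ⊕ (Fin p ⊕ Fin q)) ℝ,
      ∃ θ : Fin q → ℝ, k * kᵀ = 1 ∧ k * J (Fin p ⊕ Fin q) ℝ = J (Fin p ⊕ Fin q) ℝ * k ∧
        k * signature₂ (Fin p) (Fin q) = signature₂ (Fin p) (Fin q) * k ∧
        B = k * hypSymplectic p q θ * kᵀ := by
  -- Working with the root C gives complex positivity for free: the complex form of B is the square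
  -- of a Hermitian matrix.
  obtain ⟨C, hC, rfl⟩ := hB.exists_posDef_mul_self_eq
  have hDD := signature₂_mul_self (Fin p) (Fin q)
  have hTT := signatureTwist_mul_self (Fin p) (Fin q)
  have hTt := signatureTwist_transpose (Fin p) (Fin q)
  have hDt : (signature₂ (Fin p) (Fin q))ᴴ = signature₂ (Fin p) (Fin q) := by
    rw [conjTranspose_eq_transpose_of_trivial, signature₂_transpose]
  have hTD := signatureTwist_mul_signature₂ (Fin p) (Fin q)
  have hTJ := signatureTwist_mul_J_mul_signatureTwist (Fin p) (Fin q)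
  have hJJ := J_mul_conjTranspose_J (l := Fin p ⊕ Fin q)
  have hJJ' : (J (Fin p ⊕ Fin q) ℝ)ᴴ * J (Fin p ⊕ Fin q) ℝ = 1 := mul_eq_one_comm.1 hJJ
  have hCJ := hC.conj_eq_inv_of_mul_self hJJ hJ
  have hCD := hC.conj_eq_inv_of_mul_self (by rw [hDt, hDD]) (by rw [hDt]; exact hD)
  rw [hDt] at hCD
  set D := signature₂ (Fin p) (Fin q)
  set T := signatureTwist (Fin p) (Fin q)
  set j := J (Fin p ⊕ Fin q) ℝ
  -- D and j both invert C, so their product commutes with it.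
  have hDj : D * j * C = C * (D * j) := by
    have h1 : j * C * jᴴ = D * C * D := by rw [hCJ, hCD]
    calc D * j * C = D * (j * C * jᴴ) * j := by
          simp only [mul_assoc, hJJ', mul_one]
      _ = (D * D) * C * (D * j) := by rw [h1]; noncomm_ring
      _ = C * (D * j) := by rw [hDD, one_mul]
  have hTCT : j * (T * C * T) = T * C * T * j := by
    calc j * (T * C * T) = (T * T) * j * (T * C * T) := by rw [hTT, one_mul]
      _ = T * ((T * j * T) * C) * T := by noncomm_ring
      _ = T * (C * (T * j * T)) * T := by rw [hTJ, hDj]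
      _ = T * C * T * j * (T * T) := by noncomm_ring
      _ = _ := by rw [hTT, mul_one]
  obtain ⟨C₀, hC₀⟩ := exists_realify_eq hTCT
  have hC₀h : C₀ᴴ = C₀ := by
    apply realify_injective
    have hCt : Cᵀ = C := by
      rw [← conjTranspose_eq_transpose_of_trivial]; exact hC.isHermitian
    rw [realify_conjTranspose, hC₀, transpose_mul, transpose_mul, hTt, hCt, mul_assoc]
  have hpsd : (C₀ * C₀).PosSemidef := by
    have := posSemidef_conjTranspose_mul_self C₀
    rwa [hC₀h] at this
  have hBB : realify (C₀ * C₀) = T * (C * C) * T := by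
    rw [realify_mul, hC₀]
    calc T * C * T * (T * C * T) = T * C * (T * T) * C * T := by noncomm_ring
      _ = _ := by rw [hTT]; noncomm_ring
  have hBDB : C * C * D * (C * C) = D := by
    calc C * C * D * (C * C) = C * C * (D * (C * C) * D) * D := by
          simp only [mul_assoc, hDD, mul_one]
      _ = D := by rw [hD, hB.mul_inv_cancel, one_mul]
  have hsig : C₀ * C₀ * signature (Fin p) (Fin q) ℂ * (C₀ * C₀) = signature (Fin p) (Fin q) ℂ := by
    apply realify_injective
    rw [realify_mul _ (C₀ * C₀), realify_mul (C₀ * C₀), realify_signature, hBB]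
    change T * (C * C) * T * D * (T * (C * C) * T) = D
    calc T * (C * C) * T * D * (T * (C * C) * T) = T * (C * C) * (T * D) * T * (C * C) * T := by
          noncomm_ring
      _ = T * (C * C) * D * (T * T) * (C * C) * T := by rw [hTD]; noncomm_ring
      _ = T * (C * C * D * (C * C)) * T := by rw [hTT]; noncomm_ring
      _ = D * (T * T) := by rw [hBDB, hTD, mul_assoc]
      _ = D := by rw [hTT, mul_one]
  obtain ⟨U, hU, V, hV, θ, hBH⟩ := hpsd.exists_blockUnitary_hypRotC hqp hsig
  set K := fromBlocks U 0 0 V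
  have hKK : K * Kᴴ = 1 := by
    rw [mem_unitaryGroup_iff, star_eq_conjTranspose] at hU hV
    simp [K, fromBlocks_conjTranspose, fromBlocks_multiply, hU, hV]
  have hKs : K * signature (Fin p) (Fin q) ℂ = signature (Fin p) (Fin q) ℂ * K := by
    simp [K, signature, fromBlocks_multiply]
  have hrKD : realify K * D = D * realify K := by
    have := congrArg realify hKs
    rwa [realify_mul, realify_mul, realify_signature] at this
  have hrKK : realify K * (realify K)ᵀ = 1 := by
    rw [← realify_conjTranspose, ← realify_mul, hKK, realify_one]
  have hrKj : realify K * j = j * realify K := by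
    have h1 : J (Fin p ⊕ Fin q) ℝ = realify (Complex.I • 1) := by
      rw [realify, J]
      congr 1 <;> ext a b <;> by_cases h : a = b <;> simp [h, one_apply]
    simp only [j]
    rw [h1, ← realify_mul, ← realify_mul]
    simp
  have hkt : (T * realify K * T)ᵀ = T * (realify K)ᵀ * T := by
    rw [transpose_mul, transpose_mul, hTt, mul_assoc]
  have hkD : T * realify K * T * D = D * (T * realify K * T) := by
    calc T * realify K * T * D = T * (realify K * D) * T := by
          rw [mul_assoc, hTD]; noncomm_ring
      _ = T * D * realify K * T := by rw [hrKD]; noncomm_ring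
      _ = _ := by rw [hTD]; noncomm_ring
  have hkDj : T * realify K * T * (D * j) = D * j * (T * realify K * T) := by
    rw [← hTJ]
    calc T * realify K * T * (T * j * T) = T * realify K * (T * T) * j * T := by noncomm_ring
      _ = T * (realify K * j) * T := by rw [hTT]; noncomm_ring
      _ = T * j * 1 * realify K * T := by rw [hrKj]; noncomm_ring
      _ = _ := by rw [← hTT]; noncomm_ring
  refine ⟨T * realify K * T, θ, ?_, ?_, hkD, ?_⟩
  · rw [hkt]
    calc T * realify K * T * (T * (realify K)ᵀ * T)
        = T * realify K * (T * T) * (realify K)ᵀ * T := by noncomm_ring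
      _ = T * (realify K * (realify K)ᵀ) * T := by rw [hTT]; noncomm_ring
      _ = 1 := by rw [hrKK, mul_one, hTT]
  -- k commutes with D and with Dj, hence with j.
  · calc T * realify K * T * j = (D * D) * (T * realify K * T) * j := by rw [hDD, one_mul]
      _ = D * (D * (T * realify K * T)) * j := by noncomm_ring
      _ = D * (T * realify K * T * (D * j)) := by rw [← hkD]; noncomm_ring
      _ = (D * D) * j * (T * realify K * T) := by rw [hkDj]; noncomm_ring
      _ = _ := by rw [hDD, one_mul]
  · rw [hkt, ← signatureTwist_mul_realify_hypRotC]
    change C * C = T * realify K * T * (T * realify (hypRotC p q θ) * T) * (T * (realify K)ᵀ * T)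
    calc C * C = (T * T) * (C * C) * (T * T) := by rw [hTT, one_mul, mul_one]
      _ = T * (T * (C * C) * T) * T := by noncomm_ring
      _ = T * (realify K * 1 * realify (hypRotC p q θ) * 1 * (realify K)ᵀ) * T := by
        rw [← hBB, hBH, realify_mul, realify_mul, realify_conjTranspose, mul_one, mul_one]
      _ = _ := by rw [← hTT]; noncomm_ring

/-- `θ` is the parameter of a factorization of `S` of the form `O diag (H, H⁻¹) f (diag (Sp, Sq))`
with `O` orthogonal symplectic and `Sp`, `Sq` symplectic. -/
def IsHypParameter
    (S : Matrix ((Fin p ⊕ Fin q) ⊕ (Fin p ⊕ Fin q)) ((Fin p ⊕ Fin q) ⊕ (Fin p ⊕ Fin q)) ℝ)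
    (θ : Fin q → ℝ) : Prop :=
  ∃ O ∈ orthogonalGroup ((Fin p ⊕ Fin q) ⊕ (Fin p ⊕ Fin q)) ℝ,
    O ∈ symplecticGroup (Fin p ⊕ Fin q) ℝ ∧
    ∃ Sp ∈ symplecticGroup (Fin p) ℝ, ∃ Sq ∈ symplecticGroup (Fin q) ℝ,
      S = O * hypSymplectic p q θ * permConj p q (fromBlocks Sp 0 0 Sq)

/-- Replaces the pair (Sp, Sq) by one symplectic g centralizing D, the only form in which the right
factor is handled from here on. -/
theorem isHypParameter_iff
    {S : Matrix ((Fin p ⊕ Fin q) ⊕ (Fin p ⊕ Fin q)) ((Fin p ⊕ Fin q) ⊕ (Fin p ⊕ Fin q)) ℝ}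
    {θ : Fin q → ℝ} :
    IsHypParameter S θ ↔ ∃ O ∈ orthogonalGroup ((Fin p ⊕ Fin q) ⊕ (Fin p ⊕ Fin q)) ℝ,
      O ∈ symplecticGroup (Fin p ⊕ Fin q) ℝ ∧
      ∃ g ∈ symplecticGroup (Fin p ⊕ Fin q) ℝ,
        g * signature₂ (Fin p) (Fin q) = signature₂ (Fin p) (Fin q) * g ∧
        S = O * hypSymplectic p q θ * g := by
  constructor
  · rintro ⟨O, hO, hO', Sp, hSp, Sq, hSq, h⟩
    exact ⟨O, hO, hO', _, permConj_mem_symplecticGroup_iff.2 ⟨hSp, hSq⟩,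
      permConj_mul_signature₂ Sp Sq, h⟩
  · rintro ⟨O, hO, hO', g, hg, hgD, h⟩
    obtain ⟨A, B, rfl⟩ := exists_permConj_eq hgD
    obtain ⟨hA, hB⟩ := permConj_mem_symplecticGroup_iff.1 hg
    exact ⟨O, hO, hO', A, hA, B, hB, h⟩

theorem exists_isHypParameter (hqp : q ≤ p)
    {S : Matrix ((Fin p ⊕ Fin q) ⊕ (Fin p ⊕ Fin q)) ((Fin p ⊕ Fin q) ⊕ (Fin p ⊕ Fin q)) ℝ}
    (hS : S ∈ symplecticGroup (Fin p ⊕ Fin q) ℝ) : ∃ θ, IsHypParameter S θ := by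
  have hSu : IsUnit S := (isUnit_iff_isUnit_det S).2 (SymplecticGroup.symplectic_det hS)
  have hM : (Sᴴ * S).PosDef := by
    have := (IsUnit.posDef_star_left_conjugate_iff hSu).2 
      (PosDef.one (n := (Fin p ⊕ Fin q) ⊕ (Fin p ⊕ Fin q)) (R := ℝ))
    rwa [mul_one] at this
  have hMs : Sᴴ * S ∈ symplecticGroup (Fin p ⊕ Fin q) ℝ := by
    rw [conjTranspose_eq_transpose_of_trivial]
    exact mul_mem (SymplecticGroup.transpose_mem hS) hS
  have hDD := signature₂_mul_self (Fin p) (Fin q)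
  have hDt : (signature₂ (Fin p) (Fin q))ᴴ = signature₂ (Fin p) (Fin q) := by
    rw [conjTranspose_eq_transpose_of_trivial, signature₂_transpose]
  obtain ⟨h, N, hh, hN, hJh, hDh, hJN, hDN, hMN⟩ := hM.exists_mostow J_mul_conjTranspose_J
    hDD hDt (J_mul_signature₂ _ _) ((J_conj_eq_inv_iff hM).2 hMs)
  obtain ⟨B, hB, rfl⟩ := hN.exists_posDef_mul_self_eq
  have hJB := hB.conj_eq_inv_of_mul_self J_mul_conjTranspose_J hJN
  have hDB := hB.conj_eq_inv_of_mul_self (by rw [hDt, hDD]) (by rw [hDt]; exact hDN)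
  rw [hDt] at hDB
  obtain ⟨k, θ, hkk, hkJ, hkD, hBk⟩ := hB.exists_eq_conj_hypSymplectic hqp hJB hDB
  have hks := mem_symplecticGroup_of_orthogonal hkk hkJ
  have hhs := (J_conj_eq_inv_iff hh).1 hJh
  have hBs := (J_conj_eq_inv_iff hB).1 hJB
  have hOs : S * h⁻¹ * B⁻¹ ∈ symplecticGroup (Fin p ⊕ Fin q) ℝ :=
    mul_mem (mul_mem hS (symplecticGroup_inv_mem hhs)) (symplecticGroup_inv_mem hBs)
  have hOo : S * h⁻¹ * B⁻¹ ∈ orthogonalGroup ((Fin p ⊕ Fin q) ⊕ (Fin p ⊕ Fin q)) ℝ := by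
    rw [mem_orthogonalGroup_iff', ← conjTranspose_eq_transpose_of_trivial, conjTranspose_mul,
      conjTranspose_mul,
      hh.inv.isHermitian.eq, hB.inv.isHermitian.eq]
    calc B⁻¹ * (h⁻¹ * Sᴴ) * (S * h⁻¹ * B⁻¹) = B⁻¹ * h⁻¹ * (Sᴴ * S) * h⁻¹ * B⁻¹ := by noncomm_ring
      _ = B⁻¹ * (h⁻¹ * h) * B * (B * (h * h⁻¹) * B⁻¹) := by rw [hMN]; noncomm_ring
      _ = 1 := by
        rw [hh.inv_mul_cancel, hh.mul_inv_cancel, mul_one, mul_one, hB.inv_mul_cancel,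
          hB.mul_inv_cancel, one_mul]
  have hko : k ∈ orthogonalGroup ((Fin p ⊕ Fin q) ⊕ (Fin p ⊕ Fin q)) ℝ :=
    (mem_orthogonalGroup_iff _ _).2 hkk
  refine ⟨θ, isHypParameter_iff.2 ⟨S * h⁻¹ * B⁻¹ * k, mul_mem hOo hko, mul_mem hOs hks,
    kᵀ * h, mul_mem (SymplecticGroup.transpose_mem hks) hhs, ?_, ?_⟩⟩
  · have h1 : kᵀ * signature₂ (Fin p) (Fin q) = signature₂ (Fin p) (Fin q) * kᵀ := by
      have := congrArg transpose hkD
      rw [transpose_mul, transpose_mul, signature₂_transpose] at this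
      exact this.symm
    have h2 : h * signature₂ (Fin p) (Fin q) = signature₂ (Fin p) (Fin q) * h := by
      conv_rhs => rw [← hDh]
      rw [← mul_assoc, ← mul_assoc, hDD, one_mul]
    rw [mul_assoc, h2, ← mul_assoc, h1, mul_assoc]
  · calc S = S * (h⁻¹ * (B⁻¹ * B) * h) := by
          rw [hB.inv_mul_cancel, mul_one, hh.inv_mul_cancel, mul_one]
      _ = S * h⁻¹ * B⁻¹ * B * h := by noncomm_ring
      _ = S * h⁻¹ * B⁻¹ * (k * hypSymplectic p q θ * kᵀ) * h := by rw [← hBk]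
      _ = _ := by noncomm_ring

end Existence

/-! ### Uniqueness via a similarity invariant. -/

section Uniqueness

variable {p q : ℕ}

/-- Equal multisets of values mean fibres of equal size; bijections between the fibres glue to σ. -/
theorem Multiset.exists_perm_of_map_univ_eq {α β : Type*} [Fintype α] {f g : α → β}
    (h : Finset.univ.val.map f = Finset.univ.val.map g) :
    ∃ σ : Equiv.Perm α, ∀ a, f a = g (σ a) := by
  classical
  have hcard : ∀ c, Fintype.card {a // f a = c} = Fintype.card {a // g a = c} := fun c => by
    have := congrArg (Multiset.count c) h
    rw [Multiset.count_map, Multiset.count_map] at this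
    simp only [Fintype.card_subtype, eq_comm (b := c)]
    exact this
  exact ⟨Equiv.ofFiberEquiv fun c => Fintype.equivOfCardEq (hcard c), fun a =>
    (Equiv.ofFiberEquiv_map _ a).symm⟩

theorem hypSymplectic_mul (hqp : q ≤ p) (θ η : Fin q → ℝ) :
    hypSymplectic p q θ * hypSymplectic p q η = hypSymplectic p q (θ + η) := by
  simp [hypSymplectic, fromBlocks_multiply, hypRot_mul_hypRot hqp, add_comm]

theorem hypSymplectic_zero : hypSymplectic p q 0 = 1 := by
  simp [hypSymplectic, hypRot_zero]

theorem hypSymplectic_transpose (θ : Fin q → ℝ) :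
    (hypSymplectic p q θ)ᵀ = hypSymplectic p q θ := by
  simp [hypSymplectic, fromBlocks_transpose, hypRot_transpose]

theorem hypSymplectic_inv (hqp : q ≤ p) (θ : Fin q → ℝ) :
    (hypSymplectic p q θ)⁻¹ = hypSymplectic p q (-θ) :=
  inv_eq_right_inv (by rw [hypSymplectic_mul hqp, add_neg_cancel, hypSymplectic_zero])

theorem signature₂_mul_hypSymplectic_mul_signature₂ (θ : Fin q → ℝ) :
    signature₂ (Fin p) (Fin q) * hypSymplectic p q θ * signature₂ (Fin p) (Fin q) =
      hypSymplectic p q (-θ) := by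
  simp [signature₂, hypSymplectic, fromBlocks_multiply, ← hypRot_neg]

theorem hypRot_add_hypRot_neg (θ : Fin q → ℝ) :
    hypRot p q θ + hypRot p q (-θ) = diagonal (Sum.elim
      (fun i : Fin p => if h : i.val < q then 2 * Real.cosh (θ ⟨i.val, h⟩) else 2)
      (fun i => 2 * Real.cosh (θ i))) := by
  rw [hypRot, hypRot, threeBlock, threeBlock, fromBlocks_add, ← fromBlocks_diagonal]
  congr 1
  · rw [diagonal_add]
    congr 1
    ext i
    by_cases h : i.val < q
    · simp [h, two_mul]
    · simp [h]; norm_num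
  · ext i j
    by_cases h : i.val = j.val <;> simp [h]
  · ext i j
    by_cases h : i.val = j.val <;> simp [h]
  · rw [diagonal_add]
    congr 1
    ext i
    simp [two_mul]

-- The odd sinh blocks cancel, leaving a diagonal matrix. Each θᵢ occurs in both the p- and the
-- q-part of each of two copies, whence the exponent 4; the r = p - q fixed coordinates contribute 2
-- twice.
open Polynomial in
theorem charpoly_hypSymplectic_add (r : ℕ) (θ : Fin q → ℝ) :
    (hypSymplectic (q + r) q θ + hypSymplectic (q + r) q (-θ)).charpoly =
      (∏ i, (X - C (2 * Real.cosh (θ i)))) ^ 4 * ((X - C 2) ^ r) ^ 2 := by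
  rw [hypSymplectic, hypSymplectic, fromBlocks_add, neg_neg, add_comm (hypRot _ _ (-θ)), add_zero,
    hypRot_add_hypRot_neg, fromBlocks_diagonal, charpoly_diagonal, Fintype.prod_sum_type]
  simp only [Sum.elim_inl, Sum.elim_inr, Fintype.prod_sum_type, Fin.prod_univ_add, Fin.val_castAdd,
    Fin.is_lt, dif_pos, Fin.eta, Fin.val_natAdd, not_lt.2 (Nat.le_add_right _ _), dif_neg,
    not_false_eq_true, Finset.prod_const, Finset.card_univ, Fintype.card_fin]
  ring

open Polynomial in
theorem exists_perm_of_charpoly_eq (r : ℕ) {θ θ' : Fin q → ℝ}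
    (h : (hypSymplectic (q + r) q θ + hypSymplectic (q + r) q (-θ)).charpoly =
      (hypSymplectic (q + r) q θ' + hypSymplectic (q + r) q (-θ')).charpoly) :
    ∃ σ : Equiv.Perm (Fin q), ∀ i, θ' i = θ (σ i) ∨ θ' i = -θ (σ i) := by
  rw [charpoly_hypSymplectic_add, charpoly_hypSymplectic_add] at h
  have h4 := mul_right_cancel₀ (pow_ne_zero _ (pow_ne_zero _ (X_sub_C_ne_zero (2 : ℝ)))) h
  have hroots : ∀ η : Fin q → ℝ, (∏ i, (X - C (2 * Real.cosh (η i)))).roots =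
      Finset.univ.val.map fun i => 2 * Real.cosh (η i) := fun η => by
    have := roots_multiset_prod_X_sub_C (Finset.univ.val.map fun i => 2 * Real.cosh (η i))
    rwa [Multiset.map_map] at this
  have h5 := congrArg roots h4
  rw [roots_pow, roots_pow, hroots, hroots] at h5
  -- The fourth power multiplies every root count by 4, which can be divided out.
  have h6 : Finset.univ.val.map (fun i => 2 * Real.cosh (θ' i)) =
      Finset.univ.val.map fun i => 2 * Real.cosh (θ i) := by
    ext x
    have := congrArg (Multiset.count x) h5
    rw [Multiset.count_nsmul, Multiset.count_nsmul] at this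
    omega
  obtain ⟨σ, hσ⟩ := Multiset.exists_perm_of_map_univ_eq h6
  refine ⟨σ, fun i => ?_⟩
  have h7 : 2 * Real.cosh (θ' i) = 2 * Real.cosh (θ (σ i)) := hσ i
  have h8 : Real.cosh (θ' i) = Real.cosh (θ (σ i)) := by linarith
  exact abs_eq_abs.1 (le_antisymm (Real.cosh_le_cosh.1 h8.le) (Real.cosh_le_cosh.1 h8.ge))

/-- The similarity invariant `M⁻¹ D M D + D M⁻¹ D M` of `S`, where `M = Sᵀ S`. -/
noncomputable def signatureInvariant
    (S : Matrix ((Fin p ⊕ Fin q) ⊕ (Fin p ⊕ Fin q)) ((Fin p ⊕ Fin q) ⊕ (Fin p ⊕ Fin q)) ℝ) :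
    Matrix ((Fin p ⊕ Fin q) ⊕ (Fin p ⊕ Fin q)) ((Fin p ⊕ Fin q) ⊕ (Fin p ⊕ Fin q)) ℝ :=
  (Sᵀ * S)⁻¹ * signature₂ (Fin p) (Fin q) * (Sᵀ * S) * signature₂ (Fin p) (Fin q) +
    signature₂ (Fin p) (Fin q) * (Sᵀ * S)⁻¹ * signature₂ (Fin p) (Fin q) * (Sᵀ * S)

/-- For M = v A u with u, v centralizing D and A' = A⁻¹ = DAD, the two summands of the invariant
collapse to conjugates of A⁻² and A². Taking their sum is what later makes the sinh terms cancel. -/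
theorem twisted_conj_add {R : Type*} [Ring R] {u u' v v' D A A' : R} (hDD : D * D = 1)
    (hv : v' * v = 1) (hDv : D * v = v * D) (huD : u * D = D * u) (huD' : u' * D = D * u')
    (hA : D * A = A' * D) (hA' : D * A' = A * D) :
    u' * A' * v' * D * (v * A * u) * D + D * (u' * A' * v') * D * (v * A * u) =
      u' * (A' * A' + A * A) * u := by
  have e1 : u' * A' * v' * D * (v * A * u) * D = u' * (A' * A') * u := by
    calc _ = u' * A' * v' * (D * v) * A * (u * D) := by simp only [mul_assoc]
      _ = u' * A' * (v' * v) * (D * A) * D * u := by rw [hDv, huD]; simp only [mul_assoc]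
      _ = u' * A' * A' * (D * D) * u := by rw [hv, hA]; simp only [mul_assoc, one_mul]
      _ = _ := by rw [hDD]; simp only [mul_assoc, one_mul]
  have e2 : D * (u' * A' * v') * D * (v * A * u) = u' * (A * A) * u := by
    calc _ = (D * u') * A' * v' * (D * v) * A * u := by simp only [mul_assoc]
      _ = u' * (D * A') * (v' * v) * (D * A) * u := by rw [hDv, ← huD']; simp only [mul_assoc]
      _ = u' * A * D * A' * D * u := by rw [hv, hA, hA']; simp only [mul_assoc, one_mul]
      _ = u' * A * (D * A') * D * u := by simp only [mul_assoc]
      _ = u' * A * A * (D * D) * u := by rw [hA']; simp only [mul_assoc]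
      _ = _ := by rw [hDD]; simp only [mul_assoc, one_mul]
  rw [e1, e2, ← add_mul, ← mul_add]

/-- The factor 4 is two doublings: SᵀS contains diag(H, H⁻¹) squared, and the invariant squares it
again. -/
theorem IsHypParameter.charpoly_signatureInvariant (hqp : q ≤ p)
    {S : Matrix ((Fin p ⊕ Fin q) ⊕ (Fin p ⊕ Fin q)) ((Fin p ⊕ Fin q) ⊕ (Fin p ⊕ Fin q)) ℝ}
    {θ : Fin q → ℝ} (h : IsHypParameter S θ) :
    (signatureInvariant S).charpoly =
      (hypSymplectic p q (4 • θ) + hypSymplectic p q (-(4 • θ))).charpoly := by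
  obtain ⟨O, hO, -, g, hg, hgD, rfl⟩ := isHypParameter_iff.1 h
  have hgu : IsUnit g := (isUnit_iff_isUnit_det g).2 (SymplecticGroup.symplectic_det hg)
  obtain ⟨u, rfl⟩ := hgu
  rw [mem_orthogonalGroup_iff'] at hO
  have hDD := signature₂_mul_self (Fin p) (Fin q)
  have hDA : ∀ η, signature₂ (Fin p) (Fin q) * hypSymplectic p q η =
      hypSymplectic p q (-η) * signature₂ (Fin p) (Fin q) := fun η => by
    rw [← signature₂_mul_hypSymplectic_mul_signature₂, mul_assoc, hDD, mul_one]
  have hM : (O * hypSymplectic p q θ * u.1)ᵀ * (O * hypSymplectic p q θ * u.1) =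
      u.1ᵀ * hypSymplectic p q (θ + θ) * u.1 := by
    rw [transpose_mul, transpose_mul, hypSymplectic_transpose, ← hypSymplectic_mul hqp]
    calc _ = u.1ᵀ * hypSymplectic p q θ * (Oᵀ * O) * hypSymplectic p q θ * u.1 := by noncomm_ring
      _ = _ := by rw [hO]; noncomm_ring
  have hgDt : signature₂ (Fin p) (Fin q) * u.1ᵀ = u.1ᵀ * signature₂ (Fin p) (Fin q) := by
    have := congrArg transpose hgD
    rwa [transpose_mul, transpose_mul, signature₂_transpose] at this
  have hgi : u.1 * u.1⁻¹ = 1 := mul_nonsing_inv _ ((isUnit_iff_isUnit_det u.1).1 u.isUnit)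
  have hgi' : u.1⁻¹ * u.1 = 1 := mul_eq_one_comm.1 hgi
  have hgti : u.1ᵀ⁻¹ * u.1ᵀ = 1 := by
    rw [← transpose_nonsing_inv, ← transpose_mul, hgi, transpose_one]
  have hDgi : u.1⁻¹ * signature₂ (Fin p) (Fin q) = signature₂ (Fin p) (Fin q) * u.1⁻¹ := by
    calc u.1⁻¹ * signature₂ (Fin p) (Fin q)
        = u.1⁻¹ * signature₂ (Fin p) (Fin q) * (u.1 * u.1⁻¹) := by rw [hgi, mul_one]
      _ = u.1⁻¹ * (signature₂ (Fin p) (Fin q) * u.1) * u.1⁻¹ := by noncomm_ring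
      _ = (u.1⁻¹ * u.1) * signature₂ (Fin p) (Fin q) * u.1⁻¹ := by rw [← hgD]; noncomm_ring
      _ = _ := by rw [hgi', one_mul]
  have hMi : (u.1ᵀ * hypSymplectic p q (θ + θ) * u.1)⁻¹ =
      u.1⁻¹ * hypSymplectic p q (-(θ + θ)) * u.1ᵀ⁻¹ := by
    rw [Matrix.mul_inv_rev, Matrix.mul_inv_rev, hypSymplectic_inv hqp, mul_assoc]
  have h4 : (4 : ℕ) • θ = (θ + θ) + (θ + θ) := by
    ext i
    simp only [Pi.smul_apply, Pi.add_apply, nsmul_eq_mul]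
    norm_num
    ring
  rw [signatureInvariant, hM, hMi, h4, neg_add (θ + θ), ← hypSymplectic_mul hqp (θ + θ) (θ + θ),
    ← hypSymplectic_mul hqp (-(θ + θ)) (-(θ + θ))]
  set D := signature₂ (Fin p) (Fin q)
  set A := hypSymplectic p q (θ + θ)
  set A' := hypSymplectic p q (-(θ + θ))
  have hA : D * A = A' * D := hDA _
  have hA' : D * A' = A * D := by rw [hDA, neg_neg]
  rw [twisted_conj_add hDD hgti hgDt hgD hDgi hA hA', add_comm]
  exact charpoly_units_conj' u _

theorem IsHypParameter.exists_perm (hqp : q ≤ p)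
    {S : Matrix ((Fin p ⊕ Fin q) ⊕ (Fin p ⊕ Fin q)) ((Fin p ⊕ Fin q) ⊕ (Fin p ⊕ Fin q)) ℝ}
    {θ θ' : Fin q → ℝ} (h : IsHypParameter S θ) (h' : IsHypParameter S θ') :
    ∃ σ : Equiv.Perm (Fin q), ∀ i, θ' i = θ (σ i) ∨ θ' i = -θ (σ i) := by
  have hc := (h.charpoly_signatureInvariant hqp).symm.trans (h'.charpoly_signatureInvariant hqp)
  obtain ⟨r, rfl⟩ := Nat.exists_eq_add_of_le hqp
  obtain ⟨σ, hσ⟩ := exists_perm_of_charpoly_eq r hc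
  refine ⟨σ, fun i => (hσ i).imp (fun h => ?_) fun h => ?_⟩ <;>
  · simp only [Pi.smul_apply, nsmul_eq_mul, Nat.cast_ofNat] at h
    linarith

end Uniqueness

/-! ### Every signed permutation of the parameters occurs. -/

section SignedPermutations

variable {p q : ℕ}

/-- diag(u, u) is orthogonal, symplectic and commutes with D, so it can be moved into both O and g.
-/
theorem IsHypParameter.of_conj
    {S : Matrix ((Fin p ⊕ Fin q) ⊕ (Fin p ⊕ Fin q)) ((Fin p ⊕ Fin q) ⊕ (Fin p ⊕ Fin q)) ℝ}
    {θ θ' : Fin q → ℝ} (h : IsHypParameter S θ) {u : Matrix (Fin p ⊕ Fin q) (Fin p ⊕ Fin q) ℝ}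
    (hu : u * uᵀ = 1)
    (hud : u * signature (Fin p) (Fin q) ℝ = signature (Fin p) (Fin q) ℝ * u)
    (hθ : hypRot p q θ' = u * hypRot p q θ * uᵀ) : IsHypParameter S θ' := by
  obtain ⟨O, hO, hO', g, hg, hgD, rfl⟩ := isHypParameter_iff.1 h
  set k := fromBlocks u 0 0 u with hk
  have hkk : k * kᵀ = 1 := by simp [hk, fromBlocks_transpose, fromBlocks_multiply, hu]
  have hkk' : kᵀ * k = 1 := mul_eq_one_comm.1 hkk
  have hkJ : k * J (Fin p ⊕ Fin q) ℝ = J (Fin p ⊕ Fin q) ℝ * k := by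
    simp [hk, J, fromBlocks_multiply]
  have hkD : k * signature₂ (Fin p) (Fin q) = signature₂ (Fin p) (Fin q) * k := by
    simp [hk, signature₂, fromBlocks_multiply, hud]
  have hudt : uᵀ * signature (Fin p) (Fin q) ℝ = signature (Fin p) (Fin q) ℝ * uᵀ := by
    have := congrArg transpose hud
    rw [transpose_mul, transpose_mul, signature_transpose] at this
    exact this.symm
  have hks := mem_symplecticGroup_of_orthogonal hkk hkJ
  have hneg : hypRot p q (-θ') = u * hypRot p q (-θ) * uᵀ := by
    rw [hypRot_neg, hypRot_neg, hθ]
    simp only [mul_assoc]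
    rw [hudt, ← mul_assoc, ← hud]
    simp only [mul_assoc]
  have hA : hypSymplectic p q θ' = k * hypSymplectic p q θ * kᵀ := by
    simp [hk, hypSymplectic, fromBlocks_transpose, fromBlocks_multiply, hθ, hneg]
  refine isHypParameter_iff.2 ⟨O * kᵀ, mul_mem hO ((mem_orthogonalGroup_iff _ _).2 ?_),
    mul_mem hO' (SymplecticGroup.transpose_mem hks), k * g, mul_mem hks hg, ?_, ?_⟩
  · rw [transpose_transpose, hkk']
  · rw [mul_assoc, hgD, ← mul_assoc, hkD, mul_assoc]
  · rw [hA]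
    calc _ = O * 1 * hypSymplectic p q θ * 1 * g := by rw [mul_one, mul_one]
      _ = _ := by rw [← hkk']; noncomm_ring

theorem IsHypParameter.comp_perm (hqp : q ≤ p)
    {S : Matrix ((Fin p ⊕ Fin q) ⊕ (Fin p ⊕ Fin q)) ((Fin p ⊕ Fin q) ⊕ (Fin p ⊕ Fin q)) ℝ}
    {θ : Fin q → ℝ} (h : IsHypParameter S θ) (σ : Equiv.Perm (Fin q)) :
    IsHypParameter S (θ ∘ σ) := by
  -- σ must act simultaneously on the first q of the p-indices and on the q-indices; τ fixes the
  -- other p - q.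
  let τ : Equiv.Perm (Fin p) := σ.viaFintypeEmbedding (Fin.castLEEmb hqp)
  have hτ : ∀ i : Fin q, τ (Fin.castLE hqp i) = Fin.castLE hqp (σ i) := fun i =>
    Equiv.Perm.viaFintypeEmbedding_apply_image σ (Fin.castLEEmb hqp) i
  have hτ' : ∀ i : Fin p, ¬ i.val < q → τ i = i := fun i hi => by
    refine Equiv.Perm.viaFintypeEmbedding_apply_notMem_range σ (Fin.castLEEmb hqp) ?_
    rintro ⟨j, rfl⟩
    exact hi j.2
  have hval : ∀ (i : Fin p) (j : Fin q), (τ i).val = (σ j).val ↔ i.val = j.val := by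
    intro i j
    have : (τ i).val = (σ j).val ↔ τ i = τ (Fin.castLE hqp j) := by
      rw [hτ, Fin.ext_iff]; rfl
    rw [this, τ.injective.eq_iff, Fin.ext_iff]
    rfl
  let e : Equiv.Perm (Fin p ⊕ Fin q) := Equiv.sumCongr τ σ
  let u : Matrix (Fin p ⊕ Fin q) (Fin p ⊕ Fin q) ℝ := (1 : Matrix _ _ ℝ).submatrix e id
  have hut : uᵀ = (1 : Matrix _ _ ℝ).submatrix id e := by
    rw [transpose_submatrix, transpose_one]
  have hconj : ∀ A : Matrix (Fin p ⊕ Fin q) (Fin p ⊕ Fin q) ℝ, u * A * uᵀ = A.submatrix e e := by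
    intro A
    rw [hut]
    have h1 : u * A = A.submatrix e id := by
      have := submatrix_mul (1 : Matrix (Fin p ⊕ Fin q) (Fin p ⊕ Fin q) ℝ) A e id id
        Function.bijective_id
      rw [one_mul] at this
      exact this.symm
    have h2 := submatrix_mul A (1 : Matrix (Fin p ⊕ Fin q) (Fin p ⊕ Fin q) ℝ) e id e
      Function.bijective_id
    rw [mul_one] at h2
    rw [h1, h2]
  have hu : u * uᵀ = 1 := by
    have := hconj 1
    rwa [mul_one, submatrix_one_equiv] at this
  have hu' : uᵀ * u = 1 := mul_eq_one_comm.1 hu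
  refine h.of_conj hu ?_ ?_
  · have hsig : u * signature (Fin p) (Fin q) ℝ * uᵀ = signature (Fin p) (Fin q) ℝ := by
      have h3 : signature (Fin p) (Fin q) ℝ = diagonal (Sum.elim 1 (-1)) := by
        rw [signature, ← fromBlocks_diagonal]
        congr 1
        rw [← diagonal_one, diagonal_neg]
        rfl
      rw [hconj, h3, submatrix_diagonal_equiv]
      congr 1
      ext i
      cases i <;> simp [e]
    calc _ = u * signature (Fin p) (Fin q) ℝ * (uᵀ * u) := by rw [hu', mul_one]
      _ = u * signature (Fin p) (Fin q) ℝ * uᵀ * u := by noncomm_ring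
      _ = _ := by rw [hsig]
  · rw [hconj, hypRot, hypRot, threeBlock, threeBlock]
    ext i j
    rcases i with i | i <;> rcases j with j | j
    · simp only [fromBlocks_apply₁₁, submatrix_apply, e, Equiv.sumCongr_apply, Sum.map_inl,
        diagonal_apply, τ.injective.eq_iff]
      by_cases hij : i = j
      · subst hij
        by_cases hi : i.val < q
        · have h4 : τ i = Fin.castLE hqp (σ ⟨i.val, hi⟩) := hτ ⟨i.val, hi⟩
          simp [hi, h4]
        · simp [hi, hτ' i hi]
      · simp [hij]
    · simp [e, hval]
    · simp [e, eq_comm, hval]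
    · simp [e, diagonal_apply]

/-- Conjugation by diag(1, ε) with signs ε flips the chosen sinh entries and leaves the even cosh
entries alone. -/
theorem IsHypParameter.of_sign
    {S : Matrix ((Fin p ⊕ Fin q) ⊕ (Fin p ⊕ Fin q)) ((Fin p ⊕ Fin q) ⊕ (Fin p ⊕ Fin q)) ℝ}
    {θ θ' : Fin q → ℝ} (h : IsHypParameter S θ) (hθ : ∀ i, θ' i = θ i ∨ θ' i = -θ i) :
    IsHypParameter S θ' := by
  have hε : ∀ i, ∃ ε : ℝ, ε * ε = 1 ∧ Real.sinh (θ' i) = Real.sinh (θ i) * ε ∧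
      Real.cosh (θ' i) = Real.cosh (θ i) := fun i => by
    rcases hθ i with h | h
    · exact ⟨1, by simp, by simp [h], by rw [h]⟩
    · exact ⟨-1, by simp, by simp [h], by rw [h, Real.cosh_neg]⟩
  choose ε hε hs hc using hε
  have hd : diagonal ε * diagonal ε = 1 := by
    rw [diagonal_mul_diagonal, ← diagonal_one]
    congr 1
    exact funext hε
  refine h.of_conj (u := fromBlocks 1 0 0 (diagonal ε)) ?_ ?_ ?_
  · simp [fromBlocks_transpose, fromBlocks_multiply, hd]
  · simp [signature, fromBlocks_multiply]
  · rw [hypRot, hypRot, threeBlock, threeBlock, fromBlocks_transpose, fromBlocks_multiply,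
      fromBlocks_multiply]
    simp only [hs, hc, Matrix.one_mul, Matrix.zero_mul, Matrix.mul_zero, add_zero, zero_add,
      transpose_one, transpose_zero, Matrix.mul_one, diagonal_transpose]
    congr 1
    · ext i j
      by_cases hij : i.val = j.val <;> simp [hij]
    · ext i j
      by_cases hij : i.val = j.val <;> simp [hij, mul_comm]
    · rw [diagonal_mul_diagonal, diagonal_mul_diagonal]
      congr 1
      ext i
      rw [mul_comm (ε i), mul_assoc, hε, mul_one]

end SignedPermutations

/-! ### Assembly of existence and uniqueness. -/

theorem mainTheorem9 (p q : ℕ) (hqp : q ≤ p)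
    (S : Matrix ((Fin p ⊕ Fin q) ⊕ (Fin p ⊕ Fin q)) ((Fin p ⊕ Fin q) ⊕ (Fin p ⊕ Fin q)) ℝ)
    (hS : S ∈ symplecticGroup (Fin p ⊕ Fin q) ℝ) :
    ∃ θ : Fin q → ℝ,
      -- the factorization exists, in both of its forms
      (∃ O ∈ orthogonalGroup ((Fin p ⊕ Fin q) ⊕ (Fin p ⊕ Fin q)) ℝ,
        O ∈ symplecticGroup (Fin p ⊕ Fin q) ℝ ∧
        ∃ Sp ∈ symplecticGroup (Fin p) ℝ, ∃ Sq ∈ symplecticGroup (Fin q) ℝ,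
          S = O * fromBlocks (hypRot p q θ) 0 0 (hypRot p q θ)⁻¹ *
                permConj p q (fromBlocks Sp 0 0 Sq) ∧
          S = O *
            fromBlocks
              (threeBlock p q (fun i => Real.cosh (θ i)) (fun i => Real.sinh (θ i))) 0
              0 (threeBlock p q (fun i => Real.cosh (θ i)) (fun i => -Real.sinh (θ i))) *
            fromBlocks
              (fromBlocks Sp.toBlocks₁₁ 0 0 Sq.toBlocks₁₁)
              (fromBlocks Sp.toBlocks₁₂ 0 0 Sq.toBlocks₁₂)
              (fromBlocks Sp.toBlocks₂₁ 0 0 Sq.toBlocks₂₁)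
              (fromBlocks Sp.toBlocks₂₂ 0 0 Sq.toBlocks₂₂)) ∧
      -- the parameters of the factorizations of `S` are exactly the signed permutations of `θ`
      (∀ θ' : Fin q → ℝ,
        (∃ O ∈ orthogonalGroup ((Fin p ⊕ Fin q) ⊕ (Fin p ⊕ Fin q)) ℝ,
          O ∈ symplecticGroup (Fin p ⊕ Fin q) ℝ ∧
          ∃ Sp ∈ symplecticGroup (Fin p) ℝ, ∃ Sq ∈ symplecticGroup (Fin q) ℝ,
            S = O * fromBlocks (hypRot p q θ') 0 0 (hypRot p q θ')⁻¹ *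
                  permConj p q (fromBlocks Sp 0 0 Sq)) ↔
        ∃ σ : Equiv.Perm (Fin q), ∀ i, θ' i = θ (σ i) ∨ θ' i = -θ (σ i)) := by
  have hinv : ∀ η : Fin q → ℝ, fromBlocks (hypRot p q η) 0 0 (hypRot p q η)⁻¹ =
      hypSymplectic p q η := fun η => by rw [hypRot_inv hqp, hypSymplectic]
  obtain ⟨θ, hθ⟩ := exists_isHypParameter hqp hS
  refine ⟨θ, ?_, fun θ' => ?_⟩
  · obtain ⟨O, hO, hO', Sp, hSp, Sq, hSq, h⟩ := hθ
    refine ⟨O, hO, hO', Sp, hSp, Sq, hSq, by rw [hinv]; exact h, ?_⟩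
    rw [← permConj_fromBlocks]
    simpa [hypSymplectic, hypRot] using h
  · simp only [hinv]
    refine ⟨fun h' => hθ.exists_perm hqp h', ?_⟩
    rintro ⟨σ, hσ⟩
    exact (hθ.comp_perm hqp σ).of_sign hσ
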